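/- Let $0<\alpha\le 1$, $1<\alpha+\beta\le 2$, $c>0$, $D>0$ and $k\in\mathbb{R}$. For $u$ on $[0,\infty)$ let $\frac{d^\gamma u}{dt^\gamma}(t)=\frac{1}{\Gamma(n-\gamma)}\int_0^t (t-\tau)^{n-\gamma-1}u^{(n)}(\tau)\,d\tau$ for $n-1<\gamma<n$, $n\in\mathbb{N}$, be the Caputo derivative, and $\frac{d^n u}{dt^n}=u^{(n)}$ for $\gamma=n\in\mathbb N$. Let $Q(x,t)$, $x\in\mathbb{R}^3$, $t\ge 0$, be a fundamental solution of the fractional hyperbolic diffusion equation, that is, a solution, in the sense of tempered distributions in $x$, of $$\frac{1}{c^2}\frac{\partial^{\alpha+\beta}q}{\partial t^{\alpha+\beta}}+\frac1D\frac{\partial^\alpha q}{\partial t^\alpha}=k^2\Delta q\quad(t>0),\qquad q|_{t=0}=\delta(x),\qquad \frac{\partial q}{\partial t}\Big|_{t=0}=0,$$ where each pairing $t\mapsto\langle Q(\cdot,t),\varphi\rangle$ with a Schwartz function $\varphi$ is twice continuously differentiable on $(0,\infty)$ with second derivative integrable on $(0,T)$ for every $T>0$, and the equation and the initial conditions hold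 after pairing with $\varphi$. Then for every $t\ge0$ the Fourier transform $H(\kappa,t)=\int_{\mathbb{R}^3}e^{i\langle\kappa,x\rangle}Q(x,t)\,dx$ (understood in the sense of distributions) is a continuous function of $\kappa\in\mathbb{R}^3$, and $$H(\kappa,t)=1+\sum_{n=0}^\infty\left(-k^2\|\kappa\|^2c^2t^{\alpha+\beta}\right)^{n+1}E^{n+1}_{\beta,(\alpha+\beta)(n+1)+1}\!\left(-\frac{c^2}{D}t^\beta\right)$$ $$=1-k^2\|\kappa\|^2c^2t^{\alpha+\beta}\sum_{m=0}^\infty\sum_{n=0}^\infty\binom mn\frac{\left(-\frac{c^2}{D}t^\beta\right)^m\left(k^2\|\kappa\|^2Dt^\alpha\right)^n}{\Gamma(\beta m+\alpha n+\alpha+\beta+1)},$$ all series being convergent (the double series absolutely), where $E^{\zeta}_{a,b}(z)=\sum_{j=0}^\infty\frac{\Gamma(\zeta+j)}{\Gamma(\zeta)}\frac{z^j}{j!\,\Gamma(aj+b)}$ is the Prabhakar function. -/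

import Mathlib

open Set MeasureTheory
open scoped SchwartzMap FourierTransform Laplacian Topology

noncomputable section

namespace FracHyp

/-- Euclidean space `ℝ³`. -/
abbrev E3 : Type := EuclideanSpace ℝ (Fin 3)

/-- The Caputo derivative of order `γ > 0` with base point `0`, at time `t`. With `n = ⌈γ⌉` it is
`Γ(n-γ)⁻¹ ∫₀ᵗ (t-τ)^(n-γ-1) u⁽ⁿ⁾(τ) dτ` for `n - 1 < γ < n`, and the ordinary derivative `u⁽ⁿ⁾(t)`
for `γ = n`. -/
def caputoDeriv (γ : ℝ) (u : ℝ → ℂ) (t : ℝ) : ℂ :=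
  if γ = (⌈γ⌉₊ : ℝ) then iteratedDeriv ⌈γ⌉₊ u t
  else ((1 / Real.Gamma (⌈γ⌉₊ - γ) : ℝ) : ℂ) *
    ∫ τ in (0 : ℝ)..t, (((t - τ) ^ ((⌈γ⌉₊ : ℝ) - γ - 1) : ℝ) : ℂ) * iteratedDeriv ⌈γ⌉₊ u τ

/-- `Q` (a family of tempered distributions on `ℝ³`, indexed by the time `t ≥ 0`) is a fundamental
solution of `c⁻² ∂ₜ^(α+β) q + D⁻¹ ∂ₜ^α q = k² Δ q` with `q|ₜ₌₀ = δ` and `∂ₜ q|ₜ₌₀ = 0`.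
Distributions are differentiated in time weakly: every pairing `t ↦ ⟨Q(t), φ⟩` is twice
continuously differentiable for `t > 0`, with a second derivative integrable up to time `0`, so
that the Caputo derivatives of order at most `2` make sense. -/
structure IsFundamentalSolution (α β c D k : ℝ) (Q : ℝ → 𝓢'(E3, ℂ)) : Prop where
  contDiffOn : ∀ φ : 𝓢(E3, ℂ), ContDiffOn ℝ 2 (fun t => Q t φ) (Ioi 0)
  integrable : ∀ φ : 𝓢(E3, ℂ), ∀ T : ℝ, 0 < T →
    IntervalIntegrable (iteratedDeriv 2 (fun t => Q t φ)) volume 0 T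
  equation : ∀ φ : 𝓢(E3, ℂ), ∀ t : ℝ, 0 < t →
    ((1 / c ^ 2 : ℝ) : ℂ) * caputoDeriv (α + β) (fun s => Q s φ) t
      + ((1 / D : ℝ) : ℂ) * caputoDeriv α (fun s => Q s φ) t
      = ((k ^ 2 : ℝ) : ℂ) * (Δ (Q t)) φ
  initial : Q 0 = TemperedDistribution.delta (0 : E3)
  initial_deriv : ∀ φ : 𝓢(E3, ℂ), HasDerivWithinAt (fun t => Q t φ) 0 (Ici 0) 0

/-- The dilation `x ↦ -(2π)⁻¹ x` of `ℝ³`. -/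
def dilation : E3 ≃L[ℝ] E3 :=
  ContinuousLinearEquiv.smulLeft
    (Units.mk0 (-(2 * Real.pi)⁻¹) (neg_ne_zero.2 (inv_ne_zero Real.two_pi_pos.ne')))

/-- The Fourier transform `x ↦ ∫ exp(i⟨κ,x⟩) φ(κ) dκ` of Schwartz functions. -/
def fourierSchwartz : 𝓢(E3, ℂ) →L[ℂ] 𝓢(E3, ℂ) :=
  (SchwartzMap.compCLMOfContinuousLinearEquiv ℂ dilation) ∘L
    (FourierTransform.fourierCLM ℂ 𝓢(E3, ℂ))

theorem fourierSchwartz_apply (φ : 𝓢(E3, ℂ)) (x : E3) :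
    fourierSchwartz φ x = ∫ κ : E3, Complex.exp (Complex.I * ((inner ℝ κ x : ℝ) : ℂ)) * φ κ := by
  have h : fourierSchwartz φ x = 𝓕 (φ : E3 → ℂ) ((-(2 * Real.pi)⁻¹ : ℝ) • x) := rfl
  rw [h, Real.fourier_eq']
  refine integral_congr_ae (Filter.Eventually.of_forall fun κ => ?_)
  have hpi : Real.pi ≠ 0 := Real.pi_ne_zero
  have h2 : -2 * Real.pi * inner ℝ κ ((-(2 * Real.pi)⁻¹ : ℝ) • x) = inner ℝ κ x := by
    rw [real_inner_smul_right]
    field_simp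
  simp only [smul_eq_mul]
  rw [h2, mul_comm Complex.I]

/-- The Fourier transform `κ ↦ ∫ exp(i⟨κ,x⟩) T(x) dx` of tempered distributions, defined by
duality: `⟨T̂, φ⟩ = ⟨T, φ̂⟩`. -/
def fourierDist (T : 𝓢'(E3, ℂ)) : 𝓢'(E3, ℂ) :=
  PointwiseConvergenceCLM.precomp ℂ fourierSchwartz T

theorem fourierDist_apply (T : 𝓢'(E3, ℂ)) (φ : 𝓢(E3, ℂ)) :
    fourierDist T φ = T (fourierSchwartz φ) := rfl

/-- The distribution `T` is (given by) the continuous function `f`: `⟨T, φ⟩ = ∫ f φ` for all test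
functions `φ ∈ C_c^∞(ℝ³)`. These are dense in the Schwartz space, so that `f` determines `T`; and
`T` determines `f` at every point, since `f` is continuous. -/
def IsContinuousFunction (T : 𝓢'(E3, ℂ)) (f : E3 → ℂ) : Prop :=
  Continuous f ∧ ∀ φ : 𝓢(E3, ℂ), HasCompactSupport (φ : E3 → ℂ) → T φ = ∫ κ : E3, f κ * φ κ

/-- The `j`-th term of the Prabhakar series, with `(ζ)_j = Γ(ζ + j) / Γ(ζ)`. -/
def prabhakarTerm (ζ a b z : ℝ) (j : ℕ) : ℝ :=
  Real.Gamma (ζ + j) / Real.Gamma ζ * z ^ j / (j.factorial * Real.Gamma (a * j + b))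

/-- The Prabhakar (three-parameter Mittag-Leffler) function `E^ζ_{a,b}(z)`. -/
def prabhakar (ζ a b z : ℝ) : ℝ :=
  ∑' j : ℕ, prabhakarTerm ζ a b z j

end FracHyp

end

/-! On the Fourier side the Laplacian becomes multiplication by `-‖κ‖²`, and for each fixed `κ` the
equation would be a scalar fractional ODE. The transform is only a distribution in `κ`, however, so
it cannot be evaluated at a point. Instead, fix a compactly supported test function `φ` and consider
all moments `⟨H(t), ‖κ‖^(2i) φ⟩` at once. The equation links moment `i` to moment `i + 1`. Applying
the Riemann–Liouville integral of order `α + β` removes the Caputo derivatives (`integral_equation`)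
and leaves, for the deviations `V i` of the moments from their initial values `m i`, the Volterra
chain `V i = x (I^β (V i) + z I^(α+β) (V (i+1) + m (i+1)))`, with `x = -c²/D` and `z = k² D`.

Iterating the chain `M` times (`volterra_chain_expansion`) produces the first `M` rows of the double
series plus a remainder containing the unknown `V i` with `i ≤ M`. The remainder vanishes as soon as
the moments grow at most geometrically in `i`, uniformly in time up to `t`
(`volterra_chain_solution`).

That growth bound is the crux (`exists_geometric_bound`). Each pairing is continuous in time, hence
bounded on `[0, t]`. The Schwartz space is complete and metrizable, hence Baire, so the uniform
boundedness principle gives one finite-order seminorm controlling every `H(s)`. On functions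
supported in a fixed compact set, multiplication by `‖κ‖²` is bounded in that seminorm, so its
iterates grow geometrically.

Exchanging sum and integral then identifies `H(t)` with the continuous function `fourierKernel`. The
Prabhakar form is the same absolutely convergent double series summed along diagonals. -/

namespace FracHyp

open Filter

/-! ### Completeness of the Schwartz space and uniform boundedness -/

section Frechet

variable {E F : Type*} [NormedAddCommGroup E] [NormedSpace ℝ E] [NormedAddCommGroup F]
  [NormedSpace ℝ F] [CompleteSpace F]

/-- A series of Schwartz functions that converges absolutely in every seminorm has a sum. -/
theorem exists_schwartz_tsum (d : ℕ → 𝓢(E, F))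
    (hd : ∀ k l : ℕ, Summable fun n => SchwartzMap.seminorm ℝ k l (d n)) :
    ∃ s : 𝓢(E, F), (∀ x, s x = ∑' n, d n x) ∧
      ∀ k l : ℕ, SchwartzMap.seminorm ℝ k l s ≤ ∑' n, SchwartzMap.seminorm ℝ k l (d n) := by
  have hb : ∀ (l : ℕ) (n : ℕ) (x : E), ((l : ℕ∞) ≤ ⊤) →
      ‖iteratedFDeriv ℝ l (d n) x‖ ≤ SchwartzMap.seminorm ℝ 0 l (d n) := fun l n x _ =>
    SchwartzMap.norm_iteratedFDeriv_le_seminorm ℝ (d n) l x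
  have hsmooth : ContDiff ℝ ((⊤ : ℕ∞) : WithTop ℕ∞) fun x => ∑' n, d n x :=
    contDiff_tsum (fun n => (d n).smooth ⊤) (fun l _ => hd 0 l) hb
  have hbound : ∀ (k l : ℕ) (x : E),
      ‖x‖ ^ k * ‖iteratedFDeriv ℝ l (fun x => ∑' n, d n x) x‖
        ≤ ∑' n, SchwartzMap.seminorm ℝ k l (d n) := by
    intro k l x
    rw [iteratedFDeriv_tsum_apply (fun n => (d n).smooth ⊤) (fun l _ => hd 0 l) hb le_top]
    have hs : Summable fun n => ‖iteratedFDeriv ℝ l (d n) x‖ :=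
      (hd 0 l).of_nonneg_of_le (fun n => norm_nonneg _) fun n => hb l n x le_top
    calc ‖x‖ ^ k * ‖∑' n, iteratedFDeriv ℝ l (d n) x‖
        ≤ ‖x‖ ^ k * ∑' n, ‖iteratedFDeriv ℝ l (d n) x‖ := by
          gcongr
          exact norm_tsum_le_tsum_norm hs
      _ = ∑' n, ‖x‖ ^ k * ‖iteratedFDeriv ℝ l (d n) x‖ := tsum_mul_left.symm
      _ ≤ ∑' n, SchwartzMap.seminorm ℝ k l (d n) :=
          (hs.mul_left _).tsum_le_tsum (fun n => SchwartzMap.le_seminorm ℝ k l (d n) x) (hd k l)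
  refine ⟨⟨fun x => ∑' n, d n x, hsmooth, fun k l => ⟨_, hbound k l⟩⟩, fun x => rfl, fun k l => ?_⟩
  exact SchwartzMap.seminorm_le_bound ℝ k l _ (tsum_nonneg fun n => apply_nonneg _ _) (hbound k l)

/-- The Schwartz space is complete. -/
instance schwartz_completeSpace : CompleteSpace 𝓢(E, F) := by
  have : (uniformity 𝓢(E, F)).IsCountablyGenerated :=
    IsUniformAddGroup.uniformity_countably_generated
  -- The `n`-th entourage controls only the finitely many seminorms of index at most `n`, to within
  -- `2^(-n)`. A fixed seminorm is therefore controlled from some index on, which suffices for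
  -- summability of the increments.
  let U : ℕ → SetRel 𝓢(E, F) 𝓢(E, F) := fun n =>
    {p | ∀ k ∈ Finset.range (n + 1), ∀ l ∈ Finset.range (n + 1),
      SchwartzMap.seminorm ℝ k l (p.2 - p.1) < (1 / 2 : ℝ) ^ n}
  have hcont : ∀ k l : ℕ, Continuous (SchwartzMap.seminorm ℝ k l : 𝓢(E, F) → ℝ) := fun k l =>
    (schwartz_withSeminorms ℝ E F).continuous_seminorm (k, l)
  refine UniformSpace.complete_of_convergent_controlled_sequences U (fun n => ?_) fun u hu => ?_
  · rw [uniformity_eq_comap_nhds_zero]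
    refine ⟨{f | ∀ k ∈ Finset.range (n + 1), ∀ l ∈ Finset.range (n + 1),
      SchwartzMap.seminorm ℝ k l f < (1 / 2 : ℝ) ^ n}, ?_, fun p hp => hp⟩
    have : ∀ᶠ f in 𝓝 (0 : 𝓢(E, F)), ∀ k ∈ Finset.range (n + 1), ∀ l ∈ Finset.range (n + 1),
        SchwartzMap.seminorm ℝ k l f < (1 / 2 : ℝ) ^ n := by
      simp only [Filter.eventually_all_finset]
      intro k _ l _
      refine (hcont k l).tendsto 0 |>.eventually_lt_const ?_
      rw [map_zero]
      positivity
    exact this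
  · have hd : ∀ k l : ℕ, Summable fun n => SchwartzMap.seminorm ℝ k l (u (n + 1) - u n) := by
      intro k l
      refine Summable.of_norm_bounded_eventually_nat (g := fun n => (1 / 2 : ℝ) ^ n)
        summable_geometric_two ?_
      filter_upwards [eventually_ge_atTop (max k l)] with n hn
      rw [Real.norm_of_nonneg (apply_nonneg _ _)]
      exact (hu n n (n + 1) le_rfl n.le_succ k
        (Finset.mem_range.2 (Nat.lt_succ_of_le (le_trans (le_max_left _ _) hn))) l
        (Finset.mem_range.2 (Nat.lt_succ_of_le (le_trans (le_max_right _ _) hn)))).le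
    have htail : ∀ N : ℕ, ∃ s : 𝓢(E, F), (∀ x, s x = ∑' n, (u (n + N + 1) - u (n + N)) x) ∧
        ∀ k l : ℕ, SchwartzMap.seminorm ℝ k l s
          ≤ ∑' n, SchwartzMap.seminorm ℝ k l (u (n + N + 1) - u (n + N)) := fun N =>
      exists_schwartz_tsum (fun n => u (n + N + 1) - u (n + N)) fun k l =>
        (summable_nat_add_iff N).2 (hd k l)
    choose s hs hsn using htail
    have hsum : ∀ x, Summable fun n => (u (n + 1) - u n) x := fun x =>
      Summable.of_norm_bounded (hd 0 0) fun n => SchwartzMap.norm_le_seminorm ℝ _ x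
    have hsub : ∀ N, u N - (u 0 + s 0) = - s N := by
      intro N
      ext x
      have h1 := (hsum x).sum_add_tsum_nat_add N
      have h2 : ∑ n ∈ Finset.range N, (u (n + 1) - u n) x = u N x - u 0 x :=
        Finset.sum_range_sub (fun n => u n x) N
      have h3 : s 0 x = ∑' n, (u (n + 1) - u n) x := hs 0 x
      have h4 := hs N x
      change u N x - (u 0 x + s 0 x) = - s N x
      rw [h3, h4, ← h1, h2]
      abel
    refine ⟨u 0 + s 0, ?_⟩
    rw [(schwartz_withSeminorms ℝ E F).tendsto_nhds_atTop]
    rintro ⟨k, l⟩ ε hε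
    have h0 := tendsto_sum_nat_add fun n => SchwartzMap.seminorm ℝ k l (u (n + 1) - u n)
    obtain ⟨N, hN⟩ := eventually_atTop.1 (h0.eventually_lt_const hε)
    refine ⟨N, fun n hn => ?_⟩
    rw [hsub n, map_neg_eq_map]
    exact (hsn n k l).trans_lt (hN n hn)

instance schwartz_baireSpace : BaireSpace 𝓢(E, F) := by
  have : (uniformity 𝓢(E, F)).IsCountablyGenerated :=
    IsUniformAddGroup.uniformity_countably_generated
  infer_instance

/-- The uniform boundedness principle for tempered distributions. -/
theorem exists_seminorm_bound {E : Type*} [NormedAddCommGroup E] [NormedSpace ℝ E] {ι : Type*}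
    (T : ι → 𝓢'(E, ℂ)) (hT : ∀ φ : 𝓢(E, ℂ), ∃ B : ℝ, ∀ i, ‖T i φ‖ ≤ B) :
    ∃ (K L : ℕ) (C : ℝ), 0 ≤ C ∧ ∀ i (φ : 𝓢(E, ℂ)),
      ‖T i φ‖ ≤ C * (Finset.Iic (K, L)).sup (schwartzSeminormFamily ℂ E ℂ) φ := by
  let p : ι → Seminorm ℂ 𝓢(E, ℂ) := fun i =>
    (normSeminorm ℂ ℂ).comp (T i : 𝓢(E, ℂ) →L[ℂ] ℂ).toLinearMap
  have hp : ∀ i, Continuous (p i) := fun i => (T i : 𝓢(E, ℂ) →L[ℂ] ℂ).continuous.norm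
  have hbdd : BddAbove (range p) := by
    rw [Seminorm.bddAbove_range_iff]
    intro φ
    obtain ⟨B, hB⟩ := hT φ
    exact ⟨B, by rintro _ ⟨i, rfl⟩; exact hB i⟩
  -- The Baire property enters here, through barrelledness.
  have hcont := Seminorm.continuous_iSup p hp hbdd
  obtain ⟨s, C, -, hC⟩ := Seminorm.bound_of_continuous (schwartz_withSeminorms ℂ E ℂ) (⨆ i, p i)
    (by simpa only [Seminorm.coe_iSup_eq hbdd] using hcont)
  refine ⟨s.sup Prod.fst, s.sup Prod.snd, C, C.2, fun i φ => ?_⟩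
  have h1 : p i φ ≤ (⨆ i, p i) φ := by
    rw [Seminorm.iSup_apply hbdd]
    exact le_ciSup (f := fun i => p i φ) (Seminorm.bddAbove_range_iff.1 hbdd φ) i
  have h2 : s ⊆ Finset.Iic (s.sup Prod.fst, s.sup Prod.snd) := fun a ha =>
    Finset.mem_Iic.2 ⟨Finset.le_sup (f := Prod.fst) ha, Finset.le_sup (f := Prod.snd) ha⟩
  have h3 : s.sup (schwartzSeminormFamily ℂ E ℂ) φ ≤
    (Finset.Iic (s.sup Prod.fst, s.sup Prod.snd)).sup (schwartzSeminormFamily ℂ E ℂ) φ :=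
      (Finset.sup_mono h2 : s.sup (schwartzSeminormFamily ℂ E ℂ) ≤ _) φ
  calc ‖T i φ‖ = p i φ := rfl
    _ ≤ (⨆ i, p i) φ := h1
    _ ≤ C * s.sup (schwartzSeminormFamily ℂ E ℂ) φ := hC φ
    _ ≤ _ := by gcongr

end Frechet

/-! ### Multiplication by `‖κ‖²` and the Laplacian under the Fourier transform -/

section Multiplier

/-- Multiplication of Schwartz functions by `‖κ‖²`. -/
noncomputable def mulNormSq : 𝓢(E3, ℂ) →L[ℂ] 𝓢(E3, ℂ) :=
  SchwartzMap.smulLeftCLM ℂ fun κ : E3 => ((‖κ‖ ^ 2 : ℝ) : ℂ)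

theorem hasTemperateGrowth_ofReal_norm_sq :
    (fun κ : E3 => ((‖κ‖ ^ 2 : ℝ) : ℂ)).HasTemperateGrowth := by
  fun_prop

theorem mulNormSq_apply (φ : 𝓢(E3, ℂ)) (κ : E3) :
    mulNormSq φ κ = ((‖κ‖ ^ 2 : ℝ) : ℂ) * φ κ := by
  rw [mulNormSq, SchwartzMap.smulLeftCLM_apply_apply hasTemperateGrowth_ofReal_norm_sq, smul_eq_mul]

theorem mulNormSq_iterate_apply (φ : 𝓢(E3, ℂ)) (n : ℕ) (κ : E3) :
    mulNormSq^[n] φ κ = ((‖κ‖ ^ 2 : ℝ) : ℂ) ^ n * φ κ := by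
  induction n with
  | zero => simp
  | succ n ih => rw [Function.iterate_succ_apply', mulNormSq_apply, ih, pow_succ]; ring

theorem tsupport_mulNormSq_subset (φ : 𝓢(E3, ℂ)) : tsupport (mulNormSq φ) ⊆ tsupport φ :=
  (SchwartzMap.tsupport_smulLeftCLM_subset _ φ).trans inter_subset_left

theorem tsupport_mulNormSq_iterate_subset (φ : 𝓢(E3, ℂ)) (n : ℕ) :
    tsupport (mulNormSq^[n] φ) ⊆ tsupport φ := by
  induction n with
  | zero => exact subset_rfl
  | succ n ih =>
    rw [Function.iterate_succ_apply']
    exact (tsupport_mulNormSq_subset _).trans ih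

/-- Multiplication by a smooth function costs no derivatives on functions with support in a fixed
compact set. -/
theorem exists_seminorm_mulNormSq_le {S : Set E3} (hS : IsCompact S) (K L : ℕ) :
    ∃ A : ℝ, 0 ≤ A ∧ ∀ φ : 𝓢(E3, ℂ), tsupport φ ⊆ S →
      (Finset.Iic (K, L)).sup (schwartzSeminormFamily ℂ E3 ℂ) (mulNormSq φ)
        ≤ A * (Finset.Iic (K, L)).sup (schwartzSeminormFamily ℂ E3 ℂ) φ := by
  have hsm : ContDiff ℝ ((⊤ : ℕ∞) : WithTop ℕ∞) fun κ : E3 => ((‖κ‖ ^ 2 : ℝ) : ℂ) :=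
    hasTemperateGrowth_ofReal_norm_sq.1
  have hB : ∃ B : ℝ, 0 ≤ B ∧ ∀ j ≤ L, ∀ x ∈ S,
      ‖iteratedFDeriv ℝ j (fun κ : E3 => ((‖κ‖ ^ 2 : ℝ) : ℂ)) x‖ ≤ B := by
    have hj : ∀ j : ℕ, ∃ B : ℝ, ∀ x ∈ S,
        ‖iteratedFDeriv ℝ j (fun κ : E3 => ((‖κ‖ ^ 2 : ℝ) : ℂ)) x‖ ≤ B := fun j =>
      hS.exists_bound_of_continuousOn
        (hsm.continuous_iteratedFDeriv (mod_cast le_top)).continuousOn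
    choose B hB using hj
    refine ⟨∑ j ∈ Finset.range (L + 1), |B j|, Finset.sum_nonneg fun j _ => abs_nonneg _,
      fun j hj x hx => (hB j x hx).trans ((le_abs_self _).trans ?_)⟩
    exact Finset.single_le_sum (f := fun j => |B j|) (fun j _ => abs_nonneg _)
      (Finset.mem_range.2 (Nat.lt_succ_of_le hj))
  obtain ⟨B, hB0, hB⟩ := hB
  refine ⟨2 ^ L * B, by positivity, fun φ hφ => ?_⟩
  set P := (Finset.Iic (K, L)).sup (schwartzSeminormFamily ℂ E3 ℂ) with hP
  have hP0 : 0 ≤ P φ := apply_nonneg _ _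
  refine Seminorm.finset_sup_apply_le (by positivity) ?_
  rintro ⟨k, l⟩ hkl
  obtain ⟨hk, hl⟩ : k ≤ K ∧ l ≤ L := Finset.mem_Iic.1 hkl
  refine SchwartzMap.seminorm_le_bound ℂ k l _ (by positivity) fun x => ?_
  -- Off the support the derivative vanishes, so derivatives of `‖κ‖²` need bounding only on the
  -- compact set `S`. This is why the order `(K, L)` of the seminorm does not increase.
  by_cases hx : x ∈ tsupport (mulNormSq φ)
  swap
  · have h0 : iteratedFDeriv ℝ l (mulNormSq φ) x = 0 := by
      by_contra h
      exact hx (support_iteratedFDeriv_subset l h)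
    rw [h0, norm_zero, mul_zero]
    positivity
  have hxS : x ∈ S := hφ (tsupport_mulNormSq_subset φ hx)
  have hfun : (mulNormSq φ : E3 → ℂ) = fun κ => ((‖κ‖ ^ 2 : ℝ) : ℂ) * φ κ :=
    funext (mulNormSq_apply φ)
  have hle := norm_iteratedFDeriv_mul_le (𝕜 := ℝ) hsm (φ.smooth ⊤) x (n := l) (mod_cast le_top)
  calc ‖x‖ ^ k * ‖iteratedFDeriv ℝ l (mulNormSq φ) x‖
      ≤ ‖x‖ ^ k * ∑ i ∈ Finset.range (l + 1), (l.choose i : ℝ) *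
          ‖iteratedFDeriv ℝ i (fun κ : E3 => ((‖κ‖ ^ 2 : ℝ) : ℂ)) x‖ *
          ‖iteratedFDeriv ℝ (l - i) φ x‖ := by
        rw [hfun]
        gcongr
    _ = ∑ i ∈ Finset.range (l + 1), (l.choose i : ℝ) *
          (‖iteratedFDeriv ℝ i (fun κ : E3 => ((‖κ‖ ^ 2 : ℝ) : ℂ)) x‖ *
          (‖x‖ ^ k * ‖iteratedFDeriv ℝ (l - i) φ x‖)) := by
        rw [Finset.mul_sum]
        exact Finset.sum_congr rfl fun i _ => by ring
    _ ≤ ∑ i ∈ Finset.range (l + 1), (l.choose i : ℝ) * (B * P φ) := by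
        refine Finset.sum_le_sum fun i hi => ?_
        have hil : i ≤ L := (Nat.lt_succ_iff.1 (Finset.mem_range.1 hi)).trans hl
        have h1 : ‖x‖ ^ k * ‖iteratedFDeriv ℝ (l - i) φ x‖ ≤ P φ := by
          refine (SchwartzMap.le_seminorm ℂ k (l - i) φ x).trans ?_
          have hmem : ((k, l - i) : ℕ × ℕ) ∈ Finset.Iic (K, L) :=
            Finset.mem_Iic.2 ⟨hk, (Nat.sub_le _ _).trans hl⟩
          exact (Finset.le_sup hmem : schwartzSeminormFamily ℂ E3 ℂ (k, l - i) ≤ _) φ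
        gcongr
        exact hB i hil x hxS
    _ = 2 ^ l * (B * P φ) := by
        rw [← Finset.sum_mul]
        congr 1
        exact_mod_cast Nat.sum_range_choose l
    _ ≤ 2 ^ L * (B * P φ) := by
        gcongr
        norm_num
    _ = 2 ^ L * B * P φ := by ring

/-- A pointwise bounded family of distributions grows at most geometrically along the moments
`‖κ‖^(2n) φ` of a compactly supported test function. -/
theorem exists_geometric_bound {ι : Type*} (T : ι → 𝓢'(E3, ℂ))
    (hT : ∀ φ : 𝓢(E3, ℂ), ∃ B : ℝ, ∀ i, ‖T i φ‖ ≤ B) (φ : 𝓢(E3, ℂ))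
    (hφ : HasCompactSupport (φ : E3 → ℂ)) :
    ∃ C A : ℝ, 0 ≤ C ∧ 0 ≤ A ∧ ∀ i n, ‖T i (mulNormSq^[n] φ)‖ ≤ C * A ^ n := by
  obtain ⟨K, L, C, hC0, hC⟩ := exists_seminorm_bound T hT
  obtain ⟨A, hA0, hA⟩ := exists_seminorm_mulNormSq_le hφ.isCompact K L
  set P := (Finset.Iic (K, L)).sup (schwartzSeminormFamily ℂ E3 ℂ) with hP
  refine ⟨C * P φ, A, mul_nonneg hC0 (apply_nonneg _ _), hA0, fun i n => ?_⟩
  have hn : ∀ n, P (mulNormSq^[n] φ) ≤ A ^ n * P φ := by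
    intro n
    induction n with
    | zero => simp
    | succ n ih =>
      rw [Function.iterate_succ_apply']
      calc P (mulNormSq (mulNormSq^[n] φ)) ≤ A * P (mulNormSq^[n] φ) :=
            hA _ (tsupport_mulNormSq_iterate_subset φ n)
        _ ≤ A * (A ^ n * P φ) := by gcongr
        _ = A ^ (n + 1) * P φ := by ring
  calc ‖T i (mulNormSq^[n] φ)‖ ≤ C * P (mulNormSq^[n] φ) := hC i _
    _ ≤ C * (A ^ n * P φ) := by gcongr; exact hn n
    _ = C * P φ * A ^ n := by ring

open LineDeriv in
-- The factor `-2πi` from Mathlib's normalisation meets `-(2π)⁻¹` from the dilation, leaving `i`.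
theorem lineDerivOp_fourierSchwartz (φ : 𝓢(E3, ℂ)) (m : E3) :
    ∂_{m} (fourierSchwartz φ) =
      fourierSchwartz (Complex.I • SchwartzMap.smulLeftCLM ℂ (inner ℝ · m) φ) := by
  have h1 : ∀ ψ, fourierSchwartz ψ =
      SchwartzMap.compCLMOfContinuousLinearEquiv ℂ dilation (𝓕 ψ) := fun ψ => rfl
  have h2 : dilation m = (-(2 * Real.pi)⁻¹ : ℝ) • m := rfl
  rw [h1, SchwartzMap.lineDerivOp_compCLMOfContinuousLinearEquiv, h2,
    SchwartzMap.lineDerivOp_fourier_eq, h1]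
  congr 2
  ext κ
  have hg : (inner ℝ · ((-(2 * Real.pi)⁻¹ : ℝ) • m) : E3 → ℝ).HasTemperateGrowth := by fun_prop
  have hg' : (inner ℝ · m : E3 → ℝ).HasTemperateGrowth := by fun_prop
  change -(2 * (Real.pi : ℂ) * Complex.I) •
      (SchwartzMap.smulLeftCLM ℂ (inner ℝ · ((-(2 * Real.pi)⁻¹ : ℝ) • m)) φ κ : ℂ)
    = Complex.I • (SchwartzMap.smulLeftCLM ℂ (inner ℝ · m) φ κ : ℂ)
  rw [SchwartzMap.smulLeftCLM_apply_apply hg, SchwartzMap.smulLeftCLM_apply_apply hg',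
    real_inner_smul_right]
  have hpi : (Real.pi : ℂ) ≠ 0 := by exact_mod_cast Real.pi_ne_zero
  simp only [Complex.real_smul, smul_eq_mul]
  push_cast
  field_simp

theorem laplacian_fourierSchwartz (φ : 𝓢(E3, ℂ)) :
    Δ (fourierSchwartz φ) = -fourierSchwartz (mulNormSq φ) := by
  let b := stdOrthonormalBasis ℝ E3
  rw [SchwartzMap.laplacian_eq_sum b]
  simp_rw [lineDerivOp_fourierSchwartz]
  rw [← map_sum, ← map_neg]
  congr 1
  ext κ
  have hg : ∀ m : E3, (inner ℝ · m : E3 → ℝ).HasTemperateGrowth := fun m => by fun_prop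
  have h1 : ∀ m : E3, (Complex.I • SchwartzMap.smulLeftCLM ℂ (inner ℝ · m)
      (Complex.I • SchwartzMap.smulLeftCLM ℂ (inner ℝ · m) φ)) κ
        = -((inner ℝ κ m ^ 2 : ℝ) : ℂ) * φ κ := by
    intro m
    change Complex.I • (SchwartzMap.smulLeftCLM ℂ (inner ℝ · m)
      (Complex.I • SchwartzMap.smulLeftCLM ℂ (inner ℝ · m) φ) κ : ℂ) = _
    rw [SchwartzMap.smulLeftCLM_apply_apply (hg m)]
    change Complex.I • inner ℝ κ m •
      (Complex.I • (SchwartzMap.smulLeftCLM ℂ (inner ℝ · m) φ κ : ℂ)) = _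
    rw [SchwartzMap.smulLeftCLM_apply_apply (hg m)]
    simp only [Complex.real_smul, smul_eq_mul]
    push_cast
    linear_combination ((inner ℝ κ m : ℝ) : ℂ) ^ 2 * φ κ * Complex.I_mul_I
  rw [_root_.sum_apply]
  simp_rw [h1]
  change _ = -(mulNormSq φ κ)
  rw [mulNormSq_apply, ← b.sum_sq_inner_left, ← Finset.sum_mul, Finset.sum_neg_distrib]
  push_cast
  ring

theorem laplacian_fourierDist (T : 𝓢'(E3, ℂ)) (φ : 𝓢(E3, ℂ)) :
    (Δ T) (fourierSchwartz φ) = -fourierDist T (mulNormSq φ) := by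
  rw [TemperedDistribution.laplacian_apply_apply, laplacian_fourierSchwartz, map_neg,
    fourierDist_apply]

theorem fourierDist_delta (φ : 𝓢(E3, ℂ)) :
    fourierDist (TemperedDistribution.delta (0 : E3)) φ = ∫ κ : E3, φ κ := by
  rw [fourierDist_apply, TemperedDistribution.delta_apply, fourierSchwartz_apply]
  simp

end Multiplier

/-! ### Riemann–Liouville integrals and their semigroup law -/

section FractionalIntegral

/-- The Riemann–Liouville fractional integral of order `γ ≥ 0` with base point `0`. -/
noncomputable def fracInt (γ : ℝ) (u : ℝ → ℂ) (t : ℝ) : ℂ :=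
  if γ = 0 then u t
  else ((1 / Real.Gamma γ : ℝ) : ℂ) * ∫ τ in (0 : ℝ)..t, (((t - τ) ^ (γ - 1) : ℝ) : ℂ) * u τ

theorem fracInt_zero (u : ℝ → ℂ) (t : ℝ) : fracInt 0 u t = u t := if_pos rfl

theorem fracInt_of_pos {γ : ℝ} (hγ : 0 < γ) (u : ℝ → ℂ) (t : ℝ) :
    fracInt γ u t = ((1 / Real.Gamma γ : ℝ) : ℂ) *
      ∫ τ in (0 : ℝ)..t, (((t - τ) ^ (γ - 1) : ℝ) : ℂ) * u τ := if_neg hγ.ne'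

theorem fracInt_one (u : ℝ → ℂ) (t : ℝ) : fracInt 1 u t = ∫ τ in (0 : ℝ)..t, u τ := by
  rw [fracInt_of_pos one_pos]
  simp

theorem caputoDeriv_eq_fracInt (γ : ℝ) (u : ℝ → ℂ) (t : ℝ) :
    caputoDeriv γ u t = fracInt (⌈γ⌉₊ - γ) (iteratedDeriv ⌈γ⌉₊ u) t := by
  unfold caputoDeriv fracInt
  by_cases h : γ = (⌈γ⌉₊ : ℝ)
  · rw [if_pos h, if_pos (by linarith)]
  · rw [if_neg h, if_neg fun h' => h (by linarith)]

theorem fracInt_congr {γ t : ℝ} (ht : 0 < t) {u v : ℝ → ℂ} (h : ∀ s ∈ Ioc 0 t, u s = v s) :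
    fracInt γ u t = fracInt γ v t := by
  unfold fracInt
  split_ifs with hγ
  · exact h t ⟨ht, le_rfl⟩
  · congr 1
    refine intervalIntegral.integral_congr_ae (Eventually.of_forall fun s hs => ?_)
    rw [uIoc_of_le ht.le] at hs
    rw [h s hs]

theorem fracInt_const_mul (γ : ℝ) (c : ℂ) (u : ℝ → ℂ) (t : ℝ) :
    fracInt γ (fun s => c * u s) t = c * fracInt γ u t := by
  unfold fracInt
  split_ifs
  · rfl
  · rw [mul_left_comm c, ← intervalIntegral.integral_const_mul c]
    simp_rw [mul_left_comm c]

/-- The integrand of the fractional integral of order `γ` of `u` at `t` is integrable. -/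
def FracIntegrable (γ : ℝ) (u : ℝ → ℂ) (t : ℝ) : Prop :=
  IntervalIntegrable (fun τ => (((t - τ) ^ (γ - 1) : ℝ) : ℂ) * u τ) volume 0 t

theorem FracIntegrable.const_mul {γ t : ℝ} {u : ℝ → ℂ} (h : FracIntegrable γ u t) (c : ℂ) :
    FracIntegrable γ (fun s => c * u s) t := by
  refine (IntervalIntegrable.const_mul h c).congr fun s _ => ?_
  exact mul_left_comm _ _ _

theorem fracInt_add {γ t : ℝ} {u v : ℝ → ℂ} (hu : γ ≠ 0 → FracIntegrable γ u t)
    (hv : γ ≠ 0 → FracIntegrable γ v t) :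
    fracInt γ (fun s => u s + v s) t = fracInt γ u t + fracInt γ v t := by
  unfold fracInt
  split_ifs with h
  · rfl
  · rw [← mul_add, ← intervalIntegral.integral_add (hu h) (hv h)]
    simp_rw [mul_add]

theorem intervalIntegrable_sub_rpow {γ s t : ℝ} (hγ : 0 < γ) :
    IntervalIntegrable (fun τ => (t - τ) ^ (γ - 1)) volume s t := by
  have h := (intervalIntegral.intervalIntegrable_rpow' (a := t - s) (b := 0) (r := γ - 1)
    (by linarith)).comp_sub_left t
  simpa using h

theorem FracIntegrable.of_continuousOn {γ t : ℝ} (hγ : 0 < γ) {u : ℝ → ℂ}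
    (hu : ContinuousOn u (uIcc 0 t)) : FracIntegrable γ u t := by
  have h : IntervalIntegrable (fun τ => (((t - τ) ^ (γ - 1) : ℝ) : ℂ)) volume 0 t :=
    ⟨(intervalIntegrable_sub_rpow hγ).1.ofReal, (intervalIntegrable_sub_rpow hγ).2.ofReal⟩
  exact h.mul_continuousOn hu

/-- Euler's beta integral over `[s, t]`. -/
theorem integral_beta_kernel {γ δ s t : ℝ} (hγ : 0 < γ) (hδ : 0 < δ) (hst : s < t) :
    IntervalIntegrable (fun τ => (t - τ) ^ (γ - 1) * (τ - s) ^ (δ - 1)) volume s t ∧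
    ∫ τ in s..t, (t - τ) ^ (γ - 1) * (τ - s) ^ (δ - 1) =
      Real.Gamma γ * Real.Gamma δ / Real.Gamma (γ + δ) * (t - s) ^ (γ + δ - 1) := by
  have hL : 0 < t - s := sub_pos.2 hst
  have hint : IntervalIntegrable (fun τ => (t - τ) ^ (γ - 1) * (τ - s) ^ (δ - 1)) volume s t := by
    -- Splitting at the midpoint leaves one possibly singular factor on each half, the other being
    -- continuous there.
    have hmid : s < (s + t) / 2 ∧ (s + t) / 2 < t := ⟨by linarith, by linarith⟩
    refine IntervalIntegrable.trans (b := (s + t) / 2) ?_ ?_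
    · have h : IntervalIntegrable (fun τ => (τ - s) ^ (δ - 1)) volume s ((s + t) / 2) := by
        have := (intervalIntegral.intervalIntegrable_rpow' (a := 0) (b := (s + t) / 2 - s)
          (r := δ - 1) (by linarith)).comp_sub_right s
        simpa using this
      refine h.continuousOn_mul ?_
      intro x hx
      rw [uIcc_of_le hmid.1.le] at hx
      have hne : t - x ≠ 0 := (by linarith [hx.2] : 0 < t - x).ne'
      exact ((continuousAt_const.sub continuousAt_id).rpow_const (Or.inl hne)).continuousWithinAt
    · refine (intervalIntegrable_sub_rpow hγ).mul_continuousOn ?_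
      intro x hx
      rw [uIcc_of_le hmid.2.le] at hx
      have hne : x - s ≠ 0 := (by linarith [hx.1] : 0 < x - s).ne'
      exact ((continuousAt_id.sub continuousAt_const).rpow_const (Or.inl hne)).continuousWithinAt
  refine ⟨hint, ?_⟩
  have h1 : ∫ τ in s..t, (t - τ) ^ (γ - 1) * (τ - s) ^ (δ - 1) =
      ∫ x in (0 : ℝ)..(t - s), x ^ (δ - 1) * ((t - s) - x) ^ (γ - 1) := by
    have := intervalIntegral.integral_comp_sub_right (a := s) (b := t)
      (fun x => x ^ (δ - 1) * ((t - s) - x) ^ (γ - 1)) s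
    rw [sub_self] at this
    rw [← this]
    congr 1
    ext τ
    rw [mul_comm, show t - s - (τ - s) = t - τ by ring]
  have h2 := Complex.betaIntegral_scaled (δ : ℂ) (γ : ℂ) hL
  have h3 := Complex.Gamma_mul_Gamma_eq_betaIntegral (s := (δ : ℂ)) (t := (γ : ℂ))
    (by simpa using hδ) (by simpa using hγ)
  have h4 : ∫ x in (0 : ℝ)..(t - s), (x : ℂ) ^ ((δ : ℂ) - 1) * (((t - s : ℝ) : ℂ) - x) ^ ((γ : ℂ) - 1)
      = ((∫ x in (0 : ℝ)..(t - s), x ^ (δ - 1) * ((t - s) - x) ^ (γ - 1) : ℝ) : ℂ) := by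
    rw [← intervalIntegral.integral_ofReal]
    refine intervalIntegral.integral_congr fun x hx => ?_
    rw [uIcc_of_le hL.le] at hx
    rw [Complex.ofReal_mul, Complex.ofReal_cpow hx.1, Complex.ofReal_cpow (by linarith [hx.2])]
    push_cast
    rfl
  rw [h1]
  have hG : Real.Gamma (γ + δ) ≠ 0 := (Real.Gamma_pos_of_pos (by linarith)).ne'
  have h5 : Real.Gamma (γ + δ) * (∫ x in (0 : ℝ)..(t - s), x ^ (δ - 1) * ((t - s) - x) ^ (γ - 1))
      = (t - s) ^ (γ + δ - 1) * (Real.Gamma γ * Real.Gamma δ) := by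
    apply Complex.ofReal_injective
    rw [Complex.ofReal_mul, ← h4, h2]
    push_cast
    rw [Complex.ofReal_cpow hL.le, ← Complex.Gamma_ofReal, ← Complex.Gamma_ofReal,
      ← Complex.Gamma_ofReal, mul_comm (Complex.Gamma (γ : ℂ)), h3]
    push_cast
    rw [add_comm (γ : ℂ) δ]
    ring
  field_simp
  linarith

/-- The semigroup law for fractional integrals, with the integrability it rests on. -/
theorem fracInt_fracInt_aux {γ δ t : ℝ} (hγ : 0 < γ) (hδ : 0 < δ) (ht : 0 < t) {u : ℝ → ℂ}
    (hum : AEStronglyMeasurable u (volume.restrict (Ioo 0 t)))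
    (hu : FracIntegrable (γ + δ) u t) :
    FracIntegrable γ (fracInt δ u) t ∧ fracInt γ (fracInt δ u) t = fracInt (γ + δ) u t := by
  set μ := volume.restrict (Ioo (0 : ℝ) t) with hμ
  set B := Real.Gamma γ * Real.Gamma δ / Real.Gamma (γ + δ) with hB
  have hGγ := Real.Gamma_pos_of_pos hγ
  have hGδ := Real.Gamma_pos_of_pos hδ
  have hGs := Real.Gamma_pos_of_pos (add_pos hγ hδ)
  -- The indicator of `s < τ` turns Fubini on a triangle into Fubini on the square. The kernel is
  -- real and nonnegative there, so the beta integral also computes the norm and yields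
  -- integrability.
  let k : ℝ → ℝ → ℝ := fun τ s => (Ioi s).indicator (fun τ => (t - τ) ^ (γ - 1) * (τ - s) ^ (δ - 1)) τ
  have hkm : Measurable fun p : ℝ × ℝ => k p.1 p.2 := by
    have : (fun p : ℝ × ℝ => k p.1 p.2) = {p : ℝ × ℝ | p.2 < p.1}.indicator
        (fun p => (t - p.1) ^ (γ - 1) * (p.1 - p.2) ^ (δ - 1)) := by
      ext p
      rfl
    rw [this]
    exact Measurable.indicator (by fun_prop) (measurableSet_lt measurable_snd measurable_fst)
  have hk0 : ∀ᵐ s ∂μ, ∀ᵐ τ ∂μ, 0 ≤ k τ s := by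
    refine Eventually.of_forall fun s => ?_
    filter_upwards [ae_restrict_mem measurableSet_Ioo] with τ hτ
    refine indicator_apply_nonneg fun h => ?_
    have h1 : s < τ := h
    exact mul_nonneg (Real.rpow_nonneg (by linarith [hτ.2]) _)
      (Real.rpow_nonneg (by linarith) _)
  have hinter : ∀ s ∈ Ioo 0 t, Ioi s ∩ Ioo 0 t = Ioo s t := by
    intro s hs
    ext τ
    simp only [mem_inter_iff, mem_Ioi, mem_Ioo]
    exact ⟨fun h => ⟨h.1, h.2.2⟩, fun h => ⟨h.1, hs.1.trans h.1, h.2⟩⟩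
  have hks : ∀ᵐ s ∂μ, Integrable (fun τ => k τ s) μ ∧ ∫ τ, k τ s ∂μ = B * (t - s) ^ (γ + δ - 1) := by
    filter_upwards [ae_restrict_mem measurableSet_Ioo] with s hs
    obtain ⟨h1, h2⟩ := integral_beta_kernel hγ hδ hs.2
    rw [intervalIntegrable_iff_integrableOn_Ioo_of_le hs.2.le] at h1
    rw [intervalIntegral.integral_of_le hs.2.le, integral_Ioc_eq_integral_Ioo] at h2
    constructor
    · change Integrable ((Ioi s).indicator _) μ
      rw [integrable_indicator_iff measurableSet_Ioi, IntegrableOn, hμ,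
        Measure.restrict_restrict measurableSet_Ioi, hinter s hs]
      exact h1
    · change ∫ τ, (Ioi s).indicator _ τ ∂μ = _
      rw [integral_indicator measurableSet_Ioi, hμ,
        Measure.restrict_restrict measurableSet_Ioi, hinter s hs]
      exact h2
  let F : ℝ → ℝ → ℂ := fun τ s => (k τ s : ℂ) * u s
  have hui : Integrable (fun s => (((t - s) ^ (γ + δ - 1) : ℝ) : ℂ) * u s) μ := by
    have := hu
    rwa [FracIntegrable, intervalIntegrable_iff_integrableOn_Ioo_of_le ht.le] at this
  have hF : Integrable (Function.uncurry F) (μ.prod μ) := by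
    have hFm : AEStronglyMeasurable (Function.uncurry F) (μ.prod μ) :=
      (Complex.measurable_ofReal.comp hkm).aestronglyMeasurable.mul hum.comp_snd
    rw [integrable_prod_iff' hFm]
    constructor
    · filter_upwards [hks] with s hs
      exact (hs.1.ofReal (𝕜 := ℂ)).mul_const (u s)
    · refine (hui.norm.const_mul B).congr ?_
      filter_upwards [hks, hk0, ae_restrict_mem measurableSet_Ioo] with s hs h0 hs'
      have : ∀ᵐ τ ∂μ, ‖Function.uncurry F (τ, s)‖ = k τ s * ‖u s‖ := by
        filter_upwards [h0] with τ hτ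
        change ‖(k τ s : ℂ) * u s‖ = _
        rw [norm_mul, Complex.norm_of_nonneg hτ]
      rw [integral_congr_ae this, integral_mul_const, hs.2, norm_mul, Complex.norm_of_nonneg
        (Real.rpow_nonneg (by linarith [hs'.2]) _)]
      ring
  have hinner : ∀ᵐ τ ∂μ, ∫ s, F τ s ∂μ =
      (Real.Gamma δ : ℂ) * ((((t - τ) ^ (γ - 1) : ℝ) : ℂ) * fracInt δ u τ) := by
    filter_upwards [ae_restrict_mem measurableSet_Ioo] with τ hτ
    have h1 : (fun s => F τ s) = (Iio τ).indicator fun s =>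
        (((t - τ) ^ (γ - 1) : ℝ) : ℂ) * ((((τ - s) ^ (δ - 1) : ℝ) : ℂ) * u s) := by
      ext s
      by_cases h : s < τ
      · have e1 : k τ s = (t - τ) ^ (γ - 1) * (τ - s) ^ (δ - 1) := indicator_of_mem (mem_Ioi.2 h) _
        rw [indicator_of_mem (mem_Iio.2 h)]
        change (k τ s : ℂ) * u s = _
        rw [e1]
        push_cast
        ring
      · have e1 : k τ s = 0 := indicator_of_notMem (fun h' => h h') _
        rw [indicator_of_notMem (fun h' : s ∈ Iio τ => h h')]
        change (k τ s : ℂ) * u s = _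
        rw [e1]
        simp
    have h2 : Iio τ ∩ Ioo 0 t = Ioo 0 τ := by
      ext s
      simp only [mem_inter_iff, mem_Iio, mem_Ioo]
      exact ⟨fun h => ⟨h.2.1, h.1⟩, fun h => ⟨h.2, h.1, h.2.trans hτ.2⟩⟩
    rw [h1, integral_indicator measurableSet_Iio, hμ,
      Measure.restrict_restrict measurableSet_Iio, h2, integral_const_mul, fracInt_of_pos hδ,
      intervalIntegral.integral_of_le hτ.1.le, integral_Ioc_eq_integral_Ioo]
    have : (Real.Gamma δ : ℂ) ≠ 0 := by exact_mod_cast hGδ.ne'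
    push_cast
    field_simp
  have hGδ' : (Real.Gamma δ : ℂ) ≠ 0 := by exact_mod_cast hGδ.ne'
  have hres : Integrable (fun τ => (((t - τ) ^ (γ - 1) : ℝ) : ℂ) * fracInt δ u τ) μ := by
    refine (hF.integral_prod_left.const_mul ((Real.Gamma δ : ℂ)⁻¹)).congr ?_
    filter_upwards [hinner] with τ hτ
    change _ * ∫ s, F τ s ∂μ = _
    rw [hτ, inv_mul_cancel_left₀ hGδ']
  refine ⟨?_, ?_⟩
  · rw [FracIntegrable, intervalIntegrable_iff_integrableOn_Ioo_of_le ht.le]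
    exact hres
  · rw [fracInt_of_pos hγ, fracInt_of_pos (add_pos hγ hδ), intervalIntegral.integral_of_le ht.le,
      intervalIntegral.integral_of_le ht.le, integral_Ioc_eq_integral_Ioo,
      integral_Ioc_eq_integral_Ioo]
    have hswap := integral_integral_swap hF
    rw [integral_congr_ae hinner, integral_const_mul] at hswap
    have hright : ∫ s, ∫ τ, F τ s ∂μ ∂μ =
        (B : ℂ) * ∫ s, (((t - s) ^ (γ + δ - 1) : ℝ) : ℂ) * u s ∂μ := by
      rw [← integral_const_mul]
      refine integral_congr_ae ?_
      filter_upwards [hks] with s hs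
      change ∫ τ, (k τ s : ℂ) * u s ∂μ = _
      rw [integral_mul_const, integral_complex_ofReal, hs.2]
      push_cast
      ring
    rw [hright] at hswap
    have hGγ' : (Real.Gamma γ : ℂ) ≠ 0 := by exact_mod_cast hGγ.ne'
    have hGs' : (Real.Gamma (γ + δ) : ℂ) ≠ 0 := by exact_mod_cast hGs.ne'
    rw [hB] at hswap
    push_cast at hswap ⊢
    rw [← mul_right_inj' hGδ']
    calc (Real.Gamma δ : ℂ) * (1 / (Real.Gamma γ : ℂ) *
          ∫ τ in Ioo 0 t, (((t - τ) ^ (γ - 1) : ℝ) : ℂ) * fracInt δ u τ)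
        = 1 / (Real.Gamma γ : ℂ) * ((Real.Gamma δ : ℂ) *
          ∫ τ in Ioo 0 t, (((t - τ) ^ (γ - 1) : ℝ) : ℂ) * fracInt δ u τ) := by ring
      _ = _ := by
        rw [hswap]
        field_simp
        rfl

/-- Only the kernel of the total order `γ + δ` has to be integrable against `u`. This matters
because the derivatives of the solution are merely integrable near `0`. -/
theorem fracInt_fracInt {γ δ t : ℝ} (hγ : 0 ≤ γ) (hδ : 0 ≤ δ) (ht : 0 < t) {u : ℝ → ℂ}
    (hum : AEStronglyMeasurable u (volume.restrict (Ioo 0 t)))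
    (hu : FracIntegrable (γ + δ) u t) :
    (γ ≠ 0 → FracIntegrable γ (fracInt δ u) t) ∧
      fracInt γ (fracInt δ u) t = fracInt (γ + δ) u t := by
  rcases hγ.eq_or_lt with rfl | hγ
  · exact ⟨fun h => (h rfl).elim, by rw [fracInt_zero, zero_add]⟩
  rcases hδ.eq_or_lt with rfl | hδ
  · have : fracInt 0 u = u := funext (fracInt_zero u)
    rw [this, add_zero] at *
    exact ⟨fun _ => hu, rfl⟩
  · exact (fracInt_fracInt_aux hγ hδ ht hum hu).imp (fun h _ => h) id

theorem fracInt_fracInt_of_continuousOn {γ δ t : ℝ} (hγ : 0 ≤ γ) (hδ : 0 ≤ δ) (ht : 0 < t)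
    {u : ℝ → ℂ} (hu : ContinuousOn u (Ici 0)) :
    (γ ≠ 0 → FracIntegrable γ (fracInt δ u) t) ∧
      fracInt γ (fracInt δ u) t = fracInt (γ + δ) u t := by
  rcases (add_nonneg hγ hδ).eq_or_lt with h | h
  · have h1 : γ = 0 := by linarith
    subst h1
    exact ⟨fun h => (h rfl).elim, by rw [fracInt_zero, zero_add]⟩
  · refine fracInt_fracInt hγ hδ ht ?_ (FracIntegrable.of_continuousOn h (hu.mono ?_))
    · exact (hu.mono fun s hs => le_of_lt hs.1).aestronglyMeasurable measurableSet_Ioo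
    · rw [uIcc_of_le ht.le]
      exact fun s hs => hs.1

theorem integral_sub_rpow {γ t : ℝ} (hγ : 0 < γ) :
    ∫ τ in (0 : ℝ)..t, (t - τ) ^ (γ - 1) = t ^ γ / γ := by
  rw [intervalIntegral.integral_comp_sub_left (fun x => x ^ (γ - 1)) t, sub_self, sub_zero,
    integral_rpow (Or.inl (by linarith)), sub_add_cancel, Real.zero_rpow hγ.ne', sub_zero]

theorem fracInt_const {γ : ℝ} (hγ : 0 ≤ γ) (c : ℂ) (t : ℝ) :
    fracInt γ (fun _ => c) t = ((t ^ γ / Real.Gamma (γ + 1) : ℝ) : ℂ) * c := by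
  rcases hγ.eq_or_lt with rfl | hγ
  · simp [fracInt_zero]
  · rw [fracInt_of_pos hγ, intervalIntegral.integral_mul_const, intervalIntegral.integral_ofReal,
      integral_sub_rpow hγ, Real.Gamma_add_one hγ.ne']
    have h1 : (Real.Gamma γ : ℂ) ≠ 0 := by exact_mod_cast (Real.Gamma_pos_of_pos hγ).ne'
    have h2 : (γ : ℂ) ≠ 0 := by exact_mod_cast hγ.ne'
    push_cast
    field_simp

theorem norm_fracInt_le {γ t B : ℝ} (hγ : 0 ≤ γ) (ht : 0 ≤ t) {u : ℝ → ℂ}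
    (hB : ∀ s ∈ Icc 0 t, ‖u s‖ ≤ B) : ‖fracInt γ u t‖ ≤ t ^ γ / Real.Gamma (γ + 1) * B := by
  rcases hγ.eq_or_lt with rfl | hγ
  · simpa [fracInt_zero] using hB t ⟨ht, le_rfl⟩
  · have hG := Real.Gamma_pos_of_pos hγ
    have h1 : ‖∫ τ in (0 : ℝ)..t, (((t - τ) ^ (γ - 1) : ℝ) : ℂ) * u τ‖
        ≤ ∫ τ in (0 : ℝ)..t, (t - τ) ^ (γ - 1) * B := by
      refine intervalIntegral.norm_integral_le_of_norm_le ht (Eventually.of_forall fun s hs => ?_)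
        ((intervalIntegrable_sub_rpow hγ).mul_const B)
      have h0 : 0 ≤ (t - s) ^ (γ - 1) := Real.rpow_nonneg (by linarith [hs.2]) _
      rw [norm_mul, Complex.norm_of_nonneg h0]
      exact mul_le_mul_of_nonneg_left (hB s ⟨hs.1.le, hs.2⟩) h0
    rw [intervalIntegral.integral_mul_const, integral_sub_rpow hγ] at h1
    rw [fracInt_of_pos hγ, norm_mul, Complex.norm_of_nonneg (by positivity),
      Real.Gamma_add_one hγ.ne']
    calc 1 / Real.Gamma γ * ‖∫ τ in (0 : ℝ)..t, (((t - τ) ^ (γ - 1) : ℝ) : ℂ) * u τ‖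
        ≤ 1 / Real.Gamma γ * (t ^ γ / γ * B) := by gcongr
      _ = _ := by field_simp

end FractionalIntegral

/-! ### From the Caputo equation to a Volterra equation -/

section Caputo

variable {u : ℝ → ℂ}

theorem hasDerivAt_of_contDiffOn (h2 : ContDiffOn ℝ 2 u (Ioi 0)) {t : ℝ} (ht : 0 < t) :
    HasDerivAt u (deriv u t) t ∧ HasDerivAt (deriv u) (iteratedDeriv 2 u t) t := by
  have hmem : Ioi (0 : ℝ) ∈ 𝓝 t := Ioi_mem_nhds ht
  have hd : ContDiffOn ℝ 1 (deriv u) (Ioi 0) :=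
    ((contDiffOn_succ_iff_deriv_of_isOpen (n := 1) isOpen_Ioi).1 h2).2.2
  refine ⟨((h2.differentiableOn two_ne_zero).differentiableAt hmem).hasDerivAt, ?_⟩
  have : iteratedDeriv 2 u t = deriv (deriv u) t := by
    rw [iteratedDeriv_succ, iteratedDeriv_one]
  rw [this]
  exact ((hd.differentiableOn one_ne_zero).differentiableAt hmem).hasDerivAt

theorem continuousOn_Ici_of_contDiffOn (h2 : ContDiffOn ℝ 2 u (Ioi 0)) {d : ℂ}
    (h0 : HasDerivWithinAt u d (Ici 0) 0) : ContinuousOn u (Ici 0) := by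
  intro t ht
  rcases (mem_Ici.1 ht).eq_or_lt with rfl | ht
  · exact h0.continuousWithinAt
  · exact (hasDerivAt_of_contDiffOn h2 ht).1.continuousAt.continuousWithinAt

/-- The fundamental theorem on `[ε, t]` shows that `u'` has a limit at `0⁺`. This limit must be the
one-sided derivative at `0`, which is zero. -/
theorem deriv_eq_integral (h2 : ContDiffOn ℝ 2 u (Ioi 0))
    (hint : ∀ T : ℝ, 0 < T → IntervalIntegrable (iteratedDeriv 2 u) volume 0 T)
    (h0 : HasDerivWithinAt u 0 (Ici 0) 0) {t : ℝ} (ht : 0 < t) :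
    deriv u t = ∫ τ in (0 : ℝ)..t, iteratedDeriv 2 u τ := by
  have hFTC : ∀ ε ∈ Ioo 0 t, deriv u ε = deriv u t - ((∫ τ in (0 : ℝ)..t, iteratedDeriv 2 u τ)
      - ∫ τ in (0 : ℝ)..ε, iteratedDeriv 2 u τ) := by
    intro ε hε
    have h1 : ∫ τ in ε..t, iteratedDeriv 2 u τ = deriv u t - deriv u ε := by
      refine intervalIntegral.integral_eq_sub_of_hasDerivAt (fun x hx => ?_)
        ((hint ε hε.1).symm.trans (hint t ht))
      rw [uIcc_of_le hε.2.le] at hx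
      exact (hasDerivAt_of_contDiffOn h2 (hε.1.trans_le hx.1)).2
    rw [intervalIntegral.integral_interval_sub_left (hint t ht) (hint ε hε.1), h1]
    ring
  have hcont : Tendsto (fun ε => ∫ τ in (0 : ℝ)..ε, iteratedDeriv 2 u τ) (𝓝[>] 0) (𝓝 0) := by
    have h1 := intervalIntegral.continuousOn_primitive_interval
      (intervalIntegrable_iff' (by finiteness) |>.1 (hint t ht))
    rw [uIcc_of_le ht.le] at h1
    have h3 : Tendsto (fun ε => ∫ τ in (0 : ℝ)..ε, iteratedDeriv 2 u τ) (𝓝[Icc 0 t] 0)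
        (𝓝 (∫ τ in (0 : ℝ)..0, iteratedDeriv 2 u τ)) := h1 0 ⟨le_rfl, ht.le⟩
    rw [intervalIntegral.integral_same] at h3
    refine h3.mono_left ?_
    rw [← nhdsWithin_Ioo_eq_nhdsGT ht]
    exact nhdsWithin_mono _ Ioo_subset_Icc_self
  have hlim : Tendsto (fun ε => deriv u ε) (𝓝[>] 0)
      (𝓝 (deriv u t - ∫ τ in (0 : ℝ)..t, iteratedDeriv 2 u τ)) := by
    have h1 : Tendsto (fun ε => deriv u t - ((∫ τ in (0 : ℝ)..t, iteratedDeriv 2 u τ)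
        - ∫ τ in (0 : ℝ)..ε, iteratedDeriv 2 u τ)) (𝓝[>] 0)
        (𝓝 (deriv u t - ((∫ τ in (0 : ℝ)..t, iteratedDeriv 2 u τ) - 0))) :=
      (hcont.const_sub _).const_sub _
    rw [sub_zero] at h1
    refine h1.congr' ?_
    filter_upwards [Ioo_mem_nhdsGT ht] with ε hε
    exact (hFTC ε hε).symm
  have hderiv := hasDerivWithinAt_Ici_of_tendsto_deriv (s := Ioi 0)
    (h2.differentiableOn two_ne_zero) (h0.continuousWithinAt.mono Ioi_subset_Ici_self)
    self_mem_nhdsWithin hlim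
  have := (uniqueDiffWithinAt_Ici (0 : ℝ)).eq_deriv _ hderiv h0
  exact sub_eq_zero.1 this

theorem intervalIntegrable_deriv
    (h2 : ContDiffOn ℝ 2 u (Ioi 0))
    (hint : ∀ T : ℝ, 0 < T → IntervalIntegrable (iteratedDeriv 2 u) volume 0 T)
    (h0 : HasDerivWithinAt u 0 (Ici 0) 0) {t : ℝ} (ht : 0 < t) :
    IntervalIntegrable (deriv u) volume 0 t := by
  have h1 := (intervalIntegral.continuousOn_primitive_interval
    (intervalIntegrable_iff' (by finiteness) |>.1 (hint t ht))).intervalIntegrable (μ := volume)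
  refine h1.congr fun s hs => ?_
  rw [uIoc_of_le ht.le] at hs
  exact (deriv_eq_integral h2 hint h0 hs.1).symm

theorem fracInt_one_deriv
    (h2 : ContDiffOn ℝ 2 u (Ioi 0))
    (hint : ∀ T : ℝ, 0 < T → IntervalIntegrable (iteratedDeriv 2 u) volume 0 T)
    (h0 : HasDerivWithinAt u 0 (Ici 0) 0) {t : ℝ} (ht : 0 < t) : fracInt 1 (deriv u) t = u t - u 0 := by
  rw [fracInt_one]
  exact intervalIntegral.integral_eq_sub_of_hasDerivAt_of_le ht.le
    ((continuousOn_Ici_of_contDiffOn h2 h0).mono fun s hs => hs.1)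
    (fun s hs => (hasDerivAt_of_contDiffOn h2 hs.1).1) (intervalIntegrable_deriv h2 hint h0 ht)

theorem fracIntegrable_iteratedDeriv
    (hint : ∀ T : ℝ, 0 < T → IntervalIntegrable (iteratedDeriv 2 u) volume 0 T) {t : ℝ} (ht : 0 < t) :
    FracIntegrable 2 (iteratedDeriv 2 u) t := by
  refine (hint t ht).continuousOn_mul ?_
  have : (fun τ : ℝ => (((t - τ) ^ ((2 : ℝ) - 1) : ℝ) : ℂ)) = fun τ => ((t - τ : ℝ) : ℂ) := by
    ext τ
    rw [show (2 : ℝ) - 1 = 1 by norm_num, Real.rpow_one]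
  rw [this]
  fun_prop

/-- `I^γ I^(2-γ) u'' = I² u'' = I u' = u - u(0)`, the middle equality using `u'(0) = 0`. -/
theorem fracInt_caputoDeriv_of_one_lt
    (h2 : ContDiffOn ℝ 2 u (Ioi 0))
    (hint : ∀ T : ℝ, 0 < T → IntervalIntegrable (iteratedDeriv 2 u) volume 0 T)
    (h0 : HasDerivWithinAt u 0 (Ici 0) 0)
    {γ : ℝ} (h1γ : 1 < γ) (hγ2 : γ ≤ 2) {t : ℝ} (ht : 0 < t) :
    FracIntegrable γ (caputoDeriv γ u) t ∧ fracInt γ (caputoDeriv γ u) t = u t - u 0 := by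
  have hceil : ⌈γ⌉₊ = 2 := by
    rw [Nat.ceil_eq_iff (by norm_num)]
    exact ⟨by norm_num; exact h1γ, by exact_mod_cast hγ2⟩
  have hcap : caputoDeriv γ u = fracInt (2 - γ) (iteratedDeriv 2 u) := by
    ext s
    rw [caputoDeriv_eq_fracInt, hceil]
    norm_num
  have hm : AEStronglyMeasurable (iteratedDeriv 2 u) (volume.restrict (Ioo 0 t)) :=
    ((intervalIntegrable_iff_integrableOn_Ioo_of_le ht.le).1 (hint t ht)).aestronglyMeasurable
  have hI := fracIntegrable_iteratedDeriv hint ht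
  obtain ⟨hi, he⟩ := fracInt_fracInt (γ := γ) (δ := 2 - γ) (by linarith) (by linarith) ht hm
    (by rwa [show γ + (2 - γ) = 2 by ring])
  obtain ⟨-, he'⟩ := fracInt_fracInt (γ := 1) (δ := 1) zero_le_one zero_le_one ht hm
    (by rwa [show (1 : ℝ) + 1 = 2 by norm_num])
  rw [hcap]
  refine ⟨hi (by linarith), ?_⟩
  rw [he, show γ + (2 - γ) = 1 + 1 by ring, ← he', ← fracInt_one_deriv h2 hint h0 ht]
  refine fracInt_congr ht fun s hs => ?_
  rw [fracInt_one, deriv_eq_integral h2 hint h0 hs.1]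

/-- `I^(α+β) I^(1-α) u' = I^(β+1) u' = I^β (I u')`. -/
theorem fracInt_caputoDeriv_of_le_one
    (h2 : ContDiffOn ℝ 2 u (Ioi 0))
    (hint : ∀ T : ℝ, 0 < T → IntervalIntegrable (iteratedDeriv 2 u) volume 0 T)
    (h0 : HasDerivWithinAt u 0 (Ici 0) 0)
    {α β : ℝ} (hα : 0 < α) (hα1 : α ≤ 1) (hβ : 0 < β) {t : ℝ}
    (ht : 0 < t) : FracIntegrable (α + β) (caputoDeriv α u) t ∧
      fracInt (α + β) (caputoDeriv α u) t = fracInt β (fun s => u s - u 0) t := by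
  have hceil : ⌈α⌉₊ = 1 := by
    rw [Nat.ceil_eq_iff (by norm_num)]
    exact ⟨by norm_num; exact hα, by exact_mod_cast hα1⟩
  have hcap : caputoDeriv α u = fracInt (1 - α) (deriv u) := by
    ext s
    rw [caputoDeriv_eq_fracInt, hceil, iteratedDeriv_one]
    norm_num
  have hi1 := intervalIntegrable_deriv h2 hint h0 ht
  have hm : AEStronglyMeasurable (deriv u) (volume.restrict (Ioo 0 t)) :=
    ((intervalIntegrable_iff_integrableOn_Ioo_of_le ht.le).1 hi1).aestronglyMeasurable
  have hI : FracIntegrable (β + 1) (deriv u) t := by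
    refine hi1.continuousOn_mul ?_
    refine Continuous.continuousOn (Complex.continuous_ofReal.comp ?_)
    exact (continuous_const.sub continuous_id).rpow_const fun _ => Or.inr (by linarith)
  obtain ⟨hi, he⟩ := fracInt_fracInt (γ := α + β) (δ := 1 - α) (by linarith) (by linarith) ht hm
    (by rwa [show α + β + (1 - α) = β + 1 by ring])
  obtain ⟨-, he'⟩ := fracInt_fracInt (γ := β) (δ := 1) hβ.le zero_le_one ht hm hI
  rw [hcap]
  refine ⟨hi (by linarith), ?_⟩
  rw [he, show α + β + (1 - α) = β + 1 by ring, ← he']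
  exact fracInt_congr ht fun s hs => fracInt_one_deriv h2 hint h0 hs.1

/-- The Caputo differential equation in integrated form. -/
theorem integral_equation
    (h2 : ContDiffOn ℝ 2 u (Ioi 0))
    (hint : ∀ T : ℝ, 0 < T → IntervalIntegrable (iteratedDeriv 2 u) volume 0 T)
    (h0 : HasDerivWithinAt u 0 (Ici 0) 0)
    {α β c D k : ℝ} (hα₀ : 0 < α) (hα₁ : α ≤ 1) (hαβ₁ : 1 < α + β)
    (hαβ₂ : α + β ≤ 2) (hc : 0 < c) {v : ℝ → ℂ}
    (heq : ∀ t : ℝ, 0 < t → ((1 / c ^ 2 : ℝ) : ℂ) * caputoDeriv (α + β) u t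
      + ((1 / D : ℝ) : ℂ) * caputoDeriv α u t = ((k ^ 2 : ℝ) : ℂ) * -v t)
    {t : ℝ} (ht : 0 < t) :
    u t - u 0 = ((-(c ^ 2 / D) : ℝ) : ℂ) * fracInt β (fun s => u s - u 0) t
      + ((-(k ^ 2 * c ^ 2) : ℝ) : ℂ) * fracInt (α + β) v t := by
  have hβ : 0 < β := by linarith
  obtain ⟨hi1, he1⟩ := fracInt_caputoDeriv_of_one_lt h2 hint h0 hαβ₁ hαβ₂ ht
  obtain ⟨hi2, he2⟩ := fracInt_caputoDeriv_of_le_one h2 hint h0 hα₀ hα₁ hβ ht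
  have h := fracInt_congr (γ := α + β) ht fun s hs => heq s hs.1
  have hcc : (c : ℂ) ≠ 0 := by exact_mod_cast hc.ne'
  have hneg : (fun s => ((k ^ 2 : ℝ) : ℂ) * -v s) = fun s => ((-k ^ 2 : ℝ) : ℂ) * v s := by
    ext s
    push_cast
    ring
  rw [fracInt_add (fun _ => hi1.const_mul _) (fun _ => hi2.const_mul _), fracInt_const_mul,
    fracInt_const_mul, hneg, fracInt_const_mul, he1, he2] at h
  push_cast at h ⊢
  have h' : u t - u 0 = (c : ℂ) ^ 2 * (1 / (c : ℂ) ^ 2 * (u t - u 0)) := by field_simp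
  rw [h', eq_sub_of_add_eq h]
  ring

end Caputo

/-! ### Convergence of the double series and its diagonal summation -/

section Series

/-- Keep only the part `x > R` of Euler's integral, where `x^(s-1) ≥ R^(s-1)`. As `R` is free, this
makes Gamma beat any geometric growth without Stirling's formula. -/
theorem rpow_mul_exp_neg_le_Gamma {R s : ℝ} (hR : 0 < R) (hs : 1 ≤ s) :
    R ^ (s - 1) * Real.exp (-R) ≤ Real.Gamma s := by
  have hs0 : 0 < s := by linarith
  rw [Real.Gamma_eq_integral hs0, ← integral_exp_neg_Ioi R, ← integral_const_mul]
  calc ∫ x in Ioi R, R ^ (s - 1) * Real.exp (-x)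
      ≤ ∫ x in Ioi R, Real.exp (-x) * x ^ (s - 1) := by
        refine setIntegral_mono_on ((integrableOn_exp_neg_Ioi R).const_mul _)
          ((Real.GammaIntegral_convergent hs0).mono_set (Ioi_subset_Ioi hR.le))
          measurableSet_Ioi fun x hx => ?_
        rw [mul_comm]
        gcongr
        exact le_of_lt hx
    _ ≤ ∫ x in Ioi 0, Real.exp (-x) * x ^ (s - 1) := by
        refine setIntegral_mono_set (Real.GammaIntegral_convergent hs0) ?_
          (Ioi_subset_Ioi hR.le).eventuallyLE
        filter_upwards [ae_restrict_mem measurableSet_Ioi] with x hx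
        exact mul_nonneg (Real.exp_pos _).le (Real.rpow_nonneg (le_of_lt hx) _)

/-- The term with index `(m, n)` of the double series
`∑ (m choose n) X^m Z^n / Γ(β m + α n + δ)`. -/
noncomputable def doubleTerm (α β δ X Z : ℝ) (p : ℕ × ℕ) : ℝ :=
  (p.1.choose p.2 : ℝ) * (X ^ p.1 * Z ^ p.2) / Real.Gamma (β * p.1 + α * p.2 + δ)

variable {α β δ : ℝ}

theorem Gamma_double_pos (hα : 0 < α) (hβ : 0 < β) (hδ : 1 ≤ δ) (m n : ℕ) :
    0 < Real.Gamma (β * m + α * n + δ) := Real.Gamma_pos_of_pos (by positivity)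

theorem abs_doubleTerm (hα : 0 < α) (hβ : 0 < β) (hδ : 1 ≤ δ) (X Z : ℝ) (p : ℕ × ℕ) :
    |doubleTerm α β δ X Z p| = doubleTerm α β δ |X| |Z| p := by
  unfold doubleTerm
  rw [abs_div, abs_mul, abs_mul, abs_pow, abs_pow, abs_of_pos (Gamma_double_pos hα hβ hδ p.1 p.2),
    Nat.abs_cast]

theorem doubleTerm_nonneg (hα : 0 < α) (hβ : 0 < β) (hδ : 1 ≤ δ) {X Z : ℝ} (hX : 0 ≤ X)
    (hZ : 0 ≤ Z) (p : ℕ × ℕ) : 0 ≤ doubleTerm α β δ X Z p := by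
  have := Gamma_double_pos hα hβ hδ p.1 p.2
  unfold doubleTerm
  positivity

theorem doubleTerm_eq_zero_of_lt {X Z : ℝ} {m n : ℕ} (h : m < n) :
    doubleTerm α β δ X Z (m, n) = 0 := by
  simp [doubleTerm, Nat.choose_eq_zero_of_lt h]

theorem tsum_doubleTerm_row (X Z : ℝ) (m : ℕ) :
    ∑' n, doubleTerm α β δ X Z (m, n) = ∑ n ∈ Finset.range (m + 1), doubleTerm α β δ X Z (m, n) :=
  tsum_eq_sum fun n hn => doubleTerm_eq_zero_of_lt (by simpa using hn)

/-- The Gamma lower bound and the binomial theorem bound the `m`-th row by `e^R (x (1 + z)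
R^(-β))^m`, with `x = |X|` and `z = |Z|`. -/
theorem summable_doubleTerm (hα : 0 < α) (hβ : 0 < β) (hδ : 1 ≤ δ) (X Z : ℝ) :
    Summable (doubleTerm α β δ X Z) := by
  rw [← summable_abs_iff]
  simp_rw [abs_doubleTerm hα hβ hδ]
  set x := |X| with hx
  set z := |Z| with hz
  have hx0 : 0 ≤ x := abs_nonneg _
  have hz0 : 0 ≤ z := abs_nonneg _
  rw [summable_prod_of_nonneg (doubleTerm_nonneg hα hβ hδ hx0 hz0)]
  refine ⟨fun m => summable_of_ne_finset_zero (s := Finset.range (m + 1)) fun n hn =>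
    doubleTerm_eq_zero_of_lt (by simpa using hn), ?_⟩
  have hlim : Tendsto (fun R : ℝ => x * (1 + z) * R ^ (-β)) atTop (𝓝 0) := by
    simpa using (tendsto_rpow_neg_atTop hβ).const_mul (x * (1 + z))
  -- `R` is taken large enough for ratio `1/2`; `R ≥ 1` permits dropping the nonnegative part `α n +
  -- δ - 1` of the exponent.
  obtain ⟨R, hR, hR1⟩ := ((hlim.eventually_le_const (show (0 : ℝ) < 1 / 2 by norm_num)).and
    (eventually_ge_atTop 1)).exists
  have hR0 : 0 < R := by linarith
  refine Summable.of_nonneg_of_le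
    (fun m => tsum_nonneg fun n => doubleTerm_nonneg hα hβ hδ hx0 hz0 _) (fun m => ?_)
    (summable_geometric_two.mul_left (Real.exp R))
  have hterm : ∀ n, doubleTerm α β δ x z (m, n)
      ≤ Real.exp R * (x * R ^ (-β)) ^ m * (z ^ n * (m.choose n : ℝ)) := by
    intro n
    have hG := Gamma_double_pos hα hβ hδ m n
    have h1 : R ^ (β * m) * Real.exp (-R) ≤ Real.Gamma (β * m + α * n + δ) := by
      refine le_trans ?_ (rpow_mul_exp_neg_le_Gamma hR0 (s := β * m + α * n + δ)
        (by have : 0 ≤ β * m + α * n := by positivity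
            linarith))
      gcongr
      have : 0 ≤ α * n := by positivity
      linarith
    have h2 : (R ^ (-β)) ^ m = (R ^ (β * m))⁻¹ := by
      rw [← Real.rpow_natCast, ← Real.rpow_mul hR0.le, ← Real.rpow_neg hR0.le]
      congr 1
      ring
    unfold doubleTerm
    rw [div_le_iff₀ hG, mul_pow, h2]
    have h3 : 0 < R ^ (β * m) := Real.rpow_pos_of_pos hR0 _
    calc (m.choose n : ℝ) * (x ^ m * z ^ n)
        = Real.exp R * (x ^ m * (R ^ (β * m))⁻¹) * (z ^ n * (m.choose n : ℝ))
            * (R ^ (β * m) * Real.exp (-R)) := by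
          rw [Real.exp_neg]
          field_simp
      _ ≤ _ := by gcongr
  calc ∑' n, doubleTerm α β δ x z (m, n)
      = ∑ n ∈ Finset.range (m + 1), doubleTerm α β δ x z (m, n) := tsum_doubleTerm_row x z m
    _ ≤ ∑ n ∈ Finset.range (m + 1),
          Real.exp R * (x * R ^ (-β)) ^ m * (z ^ n * (m.choose n : ℝ)) :=
        Finset.sum_le_sum fun n _ => hterm n
    _ = Real.exp R * (x * (1 + z) * R ^ (-β)) ^ m := by
        have h := add_pow z 1 m
        simp only [one_pow, mul_one] at h
        rw [← Finset.mul_sum, ← h, mul_assoc, ← mul_pow]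
        ring
    _ ≤ Real.exp R * (1 / 2) ^ m := by
        gcongr

theorem doubleTerm_mul_pow (X Z r : ℝ) (p : ℕ × ℕ) :
    doubleTerm α β δ X (Z * r) p = doubleTerm α β δ X Z p * r ^ p.2 := by
  unfold doubleTerm
  rw [mul_pow]
  ring

theorem prabhakarTerm_eq (a b z : ℝ) (n j : ℕ) :
    prabhakarTerm ((n : ℝ) + 1) a b z j = ((j + n).choose n : ℝ) * z ^ j / Real.Gamma (a * j + b) := by
  unfold prabhakarTerm
  rw [show (n : ℝ) + 1 + j = ((j + n : ℕ) : ℝ) + 1 by push_cast; ring, Real.Gamma_nat_eq_factorial,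
    Real.Gamma_nat_eq_factorial, Nat.add_choose, Nat.cast_div (Nat.factorial_mul_factorial_dvd_factorial_add j n)
    (by positivity)]
  push_cast
  field_simp

/-- On the diagonal `m = j + n` the Gamma argument becomes `β j + (α+β)(n+1) + 1`, and the binomial
coefficient is the Pochhammer quotient `(n+1)_j / j!`. -/
theorem doubleTerm_diagonal (X Z : ℝ) (n j : ℕ) :
    doubleTerm α β (α + β + 1) X Z (j + n, n) =
      (X * Z) ^ n * prabhakarTerm ((n : ℝ) + 1) β ((α + β) * ((n : ℝ) + 1) + 1) X j := by
  rw [prabhakarTerm_eq]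
  unfold doubleTerm
  simp only
  rw [show β * ((j + n : ℕ) : ℝ) + α * n + (α + β + 1) = β * j + ((α + β) * ((n : ℝ) + 1) + 1) by
    push_cast; ring, pow_add, mul_pow]
  ring

theorem summable_prabhakarTerm (hα : 0 < α) (hβ : 0 < β) (X : ℝ) (n : ℕ) :
    Summable (prabhakarTerm ((n : ℝ) + 1) β ((α + β) * ((n : ℝ) + 1) + 1) X) := by
  have hδ : 1 ≤ α + β + 1 := by linarith
  have hinj : Function.Injective fun j : ℕ => (j + n, n) := fun i j h => by simpa using h
  -- With `|X|` alone the diagonal prefactor `|X|^n` could be small or zero; `|X| + 1` makes it at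
  -- least `1`.
  have h := (summable_doubleTerm hα hβ hδ (|X| + 1) 1).comp_injective hinj
  refine Summable.of_norm_bounded h fun j => ?_
  have hG : 0 < Real.Gamma (β * j + ((α + β) * ((n : ℝ) + 1) + 1)) :=
    Real.Gamma_pos_of_pos (by positivity)
  change _ ≤ doubleTerm α β (α + β + 1) (|X| + 1) 1 (j + n, n)
  rw [doubleTerm_diagonal, prabhakarTerm_eq, prabhakarTerm_eq, norm_div, norm_mul, norm_pow,
    Real.norm_eq_abs X, Real.norm_of_nonneg hG.le, Real.norm_of_nonneg (Nat.cast_nonneg _), mul_one]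
  have h1 : (1 : ℝ) ≤ (|X| + 1) ^ n := one_le_pow₀ (by linarith [abs_nonneg X])
  have h2 : |X| ^ j ≤ (|X| + 1) ^ j := by gcongr; linarith
  calc ((j + n).choose n : ℝ) * |X| ^ j / Real.Gamma (β * j + ((α + β) * ((n : ℝ) + 1) + 1))
      ≤ 1 * (((j + n).choose n : ℝ) * (|X| + 1) ^ j /
          Real.Gamma (β * j + ((α + β) * ((n : ℝ) + 1) + 1))) := by
        rw [one_mul]
        gcongr
    _ ≤ _ := by gcongr

/-- Summation of the double series along diagonals yields Prabhakar functions. -/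
theorem hasSum_prabhakar (hα : 0 < α) (hβ : 0 < β) (X Z : ℝ) :
    HasSum (fun n : ℕ => (X * Z) ^ (n + 1) *
        prabhakar ((n : ℝ) + 1) β ((α + β) * ((n : ℝ) + 1) + 1) X)
      (X * Z * ∑' p, doubleTerm α β (α + β + 1) X Z p) := by
  have hδ : 1 ≤ α + β + 1 := by linarith
  have hinj : Function.Injective fun p : ℕ × ℕ => (p.2 + p.1, p.1) := by
    rintro ⟨a, b⟩ ⟨c, d⟩ h
    simp only [Prod.mk.injEq] at h ⊢
    omega
  have hsum := (summable_doubleTerm hα hβ hδ X Z).hasSum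
  have h1 : HasSum (fun p : ℕ × ℕ => doubleTerm α β (α + β + 1) X Z (p.2 + p.1, p.1))
      (∑' p, doubleTerm α β (α + β + 1) X Z p) := by
    refine (hinj.hasSum_iff ?_).2 hsum
    rintro ⟨m, n⟩ hmn
    refine doubleTerm_eq_zero_of_lt ?_
    by_contra hle
    exact hmn ⟨(n, m - n), Prod.ext (Nat.sub_add_cancel (not_lt.1 hle)) rfl⟩
  have h2 := h1.mul_left (X * Z)
  refine h2.prod_fiberwise fun n => ?_
  have h3 : ∀ j, X * Z * doubleTerm α β (α + β + 1) X Z (j + n, n) = (X * Z) ^ (n + 1) *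
      prabhakarTerm ((n : ℝ) + 1) β ((α + β) * ((n : ℝ) + 1) + 1) X j := by
    intro j
    rw [doubleTerm_diagonal]
    ring
  simp_rw [h3]
  exact (summable_prabhakarTerm hα hβ X n).hasSum.mul_left _

end Series

/-! ### The infinite chain of Volterra equations -/

section Volterra

variable {α β : ℝ}

theorem fracInt_chain_step (hα : 0 < α) (hβ : 0 < β) {V W : ℝ → ℂ} {m x z : ℂ}
    (hV : ContinuousOn V (Ici 0)) (hW : ContinuousOn W (Ici 0))
    (heq : ∀ t : ℝ, 0 < t → V t = x * (fracInt β V t + z * fracInt (α + β) (fun s => W s + m) t))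
    {γ t : ℝ} (hγ : 0 ≤ γ) (ht : 0 < t) :
    fracInt γ V t = x * (fracInt (γ + β) V t + z * (fracInt (γ + (α + β)) W t
      + ((t ^ (γ + (α + β)) / Real.Gamma (γ + (α + β) + 1) : ℝ) : ℂ) * m)) := by
  have hWm : ContinuousOn (fun s => W s + m) (Ici 0) := hW.add continuousOn_const
  obtain ⟨hi1, he1⟩ := fracInt_fracInt_of_continuousOn (γ := γ) (δ := β) hγ hβ.le ht hV
  obtain ⟨hi2, he2⟩ := fracInt_fracInt_of_continuousOn (γ := γ) (δ := α + β) hγ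
    (by positivity) ht hWm
  have hpos : 0 < γ + (α + β) := by positivity
  have hsub : uIcc 0 t ⊆ Ici 0 := by
    rw [uIcc_of_le ht.le]
    exact fun s hs => hs.1
  rw [fracInt_congr ht fun s hs => heq s hs.1, fracInt_const_mul,
    fracInt_add hi1 fun h => (hi2 h).const_mul z, fracInt_const_mul, he1, he2,
    fracInt_add (fun _ => FracIntegrable.of_continuousOn hpos (hW.mono hsub))
      (fun _ => FracIntegrable.of_continuousOn hpos continuousOn_const), fracInt_const hpos.le]

variable {V : ℕ → ℝ → ℂ} {m : ℕ → ℂ} {x z : ℝ}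

/-- With `S` the shift `i ↦ i + 1`, this is the binomial expansion of `(x (I^β + z I^(α+β) S))^M`:
choosing the second summand `i` times gives order `β M + α i`. The constants `m (i+1)` released at
each stage integrate to powers of `t` over Gamma values, the entries of the double series. -/
theorem volterra_chain_expansion (hα : 0 < α) (hβ : 0 < β)
    (hV : ∀ i, ContinuousOn (V i) (Ici 0))
    (heq : ∀ i, ∀ t : ℝ, 0 < t → V i t = (x : ℂ) * (fracInt β (V i) t
      + (z : ℂ) * fracInt (α + β) (fun s => V (i + 1) s + m (i + 1)) t))
    {t : ℝ} (ht : 0 < t) (M : ℕ) :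
    V 0 t = ((x * z * t ^ (α + β) : ℝ) : ℂ) * (∑ N ∈ Finset.range M, ∑ i ∈ Finset.range (N + 1),
        (doubleTerm α β (α + β + 1) (x * t ^ β) (z * t ^ α) (N, i) : ℂ) * m (i + 1))
      + (x : ℂ) ^ M * ∑ i ∈ Finset.range (M + 1),
          (M.choose i : ℂ) * ((z : ℂ) ^ i * fracInt (β * M + α * i) (V i) t) := by
  induction M with
  | zero => simp [fracInt_zero]
  | succ N ih =>
    rw [Finset.sum_range_succ _ N, ih, mul_add, add_assoc (((x * z * t ^ (α + β) : ℝ) : ℂ) * _)]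
    congr 1
    have hpascal := Finset.sum_choose_succ_mul
      (fun i _ => (z : ℂ) ^ i * fracInt (β * (N + 1 : ℕ) + α * i) (V i) t) N
    rw [hpascal, ← Finset.sum_add_distrib, Finset.mul_sum, Finset.mul_sum, Finset.mul_sum,
      ← Finset.sum_add_distrib]
    refine Finset.sum_congr rfl fun i _ => ?_
    have hstep := fracInt_chain_step hα hβ (hV i) (hV (i + 1)) (heq i)
      (γ := β * N + α * i) (by positivity) ht
    have e1 : β * (N : ℝ) + α * i + β = β * ((N + 1 : ℕ) : ℝ) + α * i := by push_cast; ring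
    have e2 : β * (N : ℝ) + α * i + (α + β) = β * ((N + 1 : ℕ) : ℝ) + α * ((i + 1 : ℕ) : ℝ) := by
      push_cast; ring
    have hdt : x * z * t ^ (α + β) * doubleTerm α β (α + β + 1) (x * t ^ β) (z * t ^ α) (N, i)
        = x ^ (N + 1) * z ^ (i + 1) * (N.choose i : ℝ) * (t ^ (β * (N : ℝ) + α * i + (α + β))
          / Real.Gamma (β * (N : ℝ) + α * i + (α + β) + 1)) := by
      unfold doubleTerm
      simp only
      rw [Real.rpow_add ht (β * (N : ℝ) + α * i), Real.rpow_add ht (β * (N : ℝ)),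
        Real.rpow_mul ht.le β, Real.rpow_mul ht.le α, Real.rpow_natCast, Real.rpow_natCast,
        ← add_assoc (β * (N : ℝ) + α * i) (α + β) 1, mul_pow, mul_pow]
      ring
    have hdt' := congrArg Complex.ofReal hdt
    rw [Complex.ofReal_mul] at hdt'
    rw [← mul_assoc ((x * z * t ^ (α + β) : ℝ) : ℂ), hdt', hstep, e1, ← e2]
    generalize fracInt (β * (N : ℝ) + α * i + (α + β)) (V (i + 1)) t = P
    generalize fracInt (β * ((N + 1 : ℕ) : ℝ) + α * i) (V i) t = P'
    generalize t ^ (β * (N : ℝ) + α * i + (α + β)) /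
      Real.Gamma (β * (N : ℝ) + α * i + (α + β) + 1) = P''
    push_cast
    ring

/-- Solution of an infinite chain of fractional Volterra equations under a geometric bound. -/
theorem volterra_chain_solution (hα : 0 < α) (hβ : 0 < β)
    (hV : ∀ i, ContinuousOn (V i) (Ici 0))
    (heq : ∀ i, ∀ t : ℝ, 0 < t → V i t = (x : ℂ) * (fracInt β (V i) t
      + (z : ℂ) * fracInt (α + β) (fun s => V (i + 1) s + m (i + 1)) t))
    {t : ℝ} (ht : 0 < t) {C A : ℝ}
    (hbound : ∀ i, ∀ s ∈ Icc 0 t, ‖V i s‖ ≤ C * A ^ i)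
    (hsum : Summable fun p : ℕ × ℕ =>
      (doubleTerm α β (α + β + 1) (x * t ^ β) (z * t ^ α) p : ℂ) * m (p.2 + 1)) :
    V 0 t = ((x * z * t ^ (α + β) : ℝ) : ℂ) * ∑' p : ℕ × ℕ,
        (doubleTerm α β (α + β + 1) (x * t ^ β) (z * t ^ α) p : ℂ) * m (p.2 + 1) := by
  have hrem : Tendsto (fun M : ℕ => (x : ℂ) ^ M * ∑ i ∈ Finset.range (M + 1),
      (M.choose i : ℂ) * ((z : ℂ) ^ i * fracInt (β * M + α * i) (V i) t)) atTop (𝓝 0) := by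
    -- The remainder is dominated by `C` times the `M`-th row sum of a convergent double series with
    -- `δ = 1`, the geometric growth `A^i` being absorbed into its second variable.
    have hs := (summable_doubleTerm hα hβ le_rfl (|x| * t ^ β) (|z| * t ^ α * A)).mul_left C
    have hs' := hs.prod.tendsto_atTop_zero
    refine squeeze_zero_norm (fun M => ?_) hs'
    rw [tsum_mul_left, tsum_doubleTerm_row, Finset.mul_sum, Finset.mul_sum]
    refine (norm_sum_le _ _).trans (Finset.sum_le_sum fun i _ => ?_)
    have hb := norm_fracInt_le (γ := β * M + α * i) (by positivity) ht.le (hbound i)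
    have hdt : C * doubleTerm α β 1 (|x| * t ^ β) (|z| * t ^ α * A) (M, i) =
        |x| ^ M * ((M.choose i : ℝ) * (|z| ^ i * (t ^ (β * (M : ℝ) + α * i) /
          Real.Gamma (β * (M : ℝ) + α * i + 1) * (C * A ^ i)))) := by
      unfold doubleTerm
      simp only
      rw [Real.rpow_add ht, Real.rpow_mul ht.le β, Real.rpow_mul ht.le α, Real.rpow_natCast,
        Real.rpow_natCast, mul_pow, mul_pow, mul_pow]
      ring
    rw [hdt, norm_mul, norm_pow, Complex.norm_real, Real.norm_eq_abs, norm_mul, norm_mul, norm_pow,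
      Complex.norm_real, Real.norm_eq_abs, Complex.norm_natCast]
    gcongr
  have hlim : Tendsto (fun M : ℕ => ∑ N ∈ Finset.range M, ∑ i ∈ Finset.range (N + 1),
      (doubleTerm α β (α + β + 1) (x * t ^ β) (z * t ^ α) (N, i) : ℂ) * m (i + 1)) atTop
      (𝓝 (∑' p : ℕ × ℕ,
        (doubleTerm α β (α + β + 1) (x * t ^ β) (z * t ^ α) p : ℂ) * m (p.2 + 1))) := by
    refine (hsum.hasSum.prod_fiberwise fun N => ?_).tendsto_sum_nat
    refine hasSum_sum_of_ne_finset_zero fun i hi => ?_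
    rw [doubleTerm_eq_zero_of_lt (by simpa using hi)]
    simp
  have h := (hlim.const_mul ((x * z * t ^ (α + β) : ℝ) : ℂ)).add hrem
  rw [add_zero] at h
  refine tendsto_nhds_unique (tendsto_const_nhds.congr fun M => ?_) h
  exact volterra_chain_expansion hα hβ hV heq ht M

end Volterra

/-! ### The continuous kernel and its identification with the transform -/

section Kernel

variable {α β : ℝ}

/-- The Fourier transform of the fundamental solution, as a double series. -/
noncomputable def fourierKernel (α β x z : ℝ) (κ : E3) (t : ℝ) : ℝ :=
  1 + x * z * t ^ (α + β) * ‖κ‖ ^ 2 *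
    ∑' p, doubleTerm α β (α + β + 1) (x * t ^ β) (z * t ^ α * ‖κ‖ ^ 2) p

theorem continuous_fourierKernel (hα : 0 < α) (hβ : 0 < β) (x z t : ℝ) :
    Continuous fun κ => fourierKernel α β x z κ t := by
  have hδ : 1 ≤ α + β + 1 := by linarith
  unfold fourierKernel
  refine continuous_const.add ((continuous_const.mul (by fun_prop)).mul ?_)
  rw [continuous_iff_continuousAt]
  intro κ₀
  set R := ‖κ₀‖ + 1 with hR
  have hs := (summable_doubleTerm hα hβ hδ (x * t ^ β) (z * t ^ α * R ^ 2)).abs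
  have hcont : ContinuousOn (fun κ : E3 =>
      ∑' p, doubleTerm α β (α + β + 1) (x * t ^ β) (z * t ^ α * ‖κ‖ ^ 2) p)
      (Metric.ball (0 : E3) R) := by
    refine continuousOn_tsum (fun p => ?_) hs fun p κ hκ => ?_
    · simp_rw [doubleTerm_mul_pow]
      fun_prop
    · have hκ' : ‖κ‖ ≤ R := by simpa using (mem_ball_zero_iff.1 hκ).le
      rw [doubleTerm_mul_pow _ _ (‖κ‖ ^ 2), doubleTerm_mul_pow _ _ (R ^ 2), norm_mul, abs_mul, Real.norm_eq_abs,
        Real.norm_of_nonneg (by positivity : 0 ≤ (‖κ‖ ^ 2) ^ p.2),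
        abs_of_nonneg (by positivity : 0 ≤ (R ^ 2) ^ p.2)]
      gcongr
  exact hcont.continuousAt (Metric.isOpen_ball.mem_nhds (by simp [hR]))

/-- On the support of `φ` one has `‖κ‖ ≤ R`, so the series at `Z R²` dominates and sum and integral
may be exchanged. This supplies both the summability and the value of the sum in the chain solution.
-/
theorem hasSum_integral_doubleTerm (hα : 0 < α) (hβ : 0 < β) (X Z : ℝ) (φ : 𝓢(E3, ℂ))
    (hφ : HasCompactSupport (φ : E3 → ℂ)) :
    HasSum (fun p : ℕ × ℕ => (doubleTerm α β (α + β + 1) X Z p : ℂ) *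
        ∫ κ, mulNormSq^[p.2 + 1] φ κ)
      (∫ κ : E3, ((‖κ‖ ^ 2 * ∑' p, doubleTerm α β (α + β + 1) X (Z * ‖κ‖ ^ 2) p : ℝ) : ℂ) * φ κ) := by
  have hδ : 1 ≤ α + β + 1 := by linarith
  obtain ⟨R, hR⟩ := hφ.isCompact.isBounded.exists_norm_le
  let F : ℕ × ℕ → E3 → ℂ := fun p κ =>
    (doubleTerm α β (α + β + 1) X Z p : ℂ) * mulNormSq^[p.2 + 1] φ κ
  have hFint : ∀ p, Integrable (F p) := fun p => (mulNormSq^[p.2 + 1] φ).integrable.const_mul _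
  have hFnorm : ∀ p κ, ‖F p κ‖ ≤
      |doubleTerm α β (α + β + 1) X (Z * R ^ 2) p| * (R ^ 2 * ‖φ κ‖) := by
    intro p κ
    change ‖(doubleTerm α β (α + β + 1) X Z p : ℂ) * mulNormSq^[p.2 + 1] φ κ‖ ≤ _
    rw [mulNormSq_iterate_apply, norm_mul, norm_mul, norm_pow, Complex.norm_real, Complex.norm_real,
      Real.norm_of_nonneg (by positivity : 0 ≤ ‖κ‖ ^ 2), Real.norm_eq_abs, doubleTerm_mul_pow,
      abs_mul, abs_of_nonneg (by positivity : 0 ≤ (R ^ 2) ^ p.2)]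
    by_cases hκ : φ κ = 0
    · simp [hκ]
    · have hκR : ‖κ‖ ≤ R := hR κ (subset_tsupport _ hκ)
      calc |doubleTerm α β (α + β + 1) X Z p| * ((‖κ‖ ^ 2) ^ (p.2 + 1) * ‖φ κ‖)
          ≤ |doubleTerm α β (α + β + 1) X Z p| * ((R ^ 2) ^ (p.2 + 1) * ‖φ κ‖) := by gcongr
        _ = _ := by ring
  have hsum : Summable fun p => ∫ κ, ‖F p κ‖ := by
    refine Summable.of_nonneg_of_le (fun p => integral_nonneg fun κ => norm_nonneg _) (fun p => ?_)
      ((summable_doubleTerm hα hβ hδ X (Z * R ^ 2)).abs.mul_right (∫ κ, R ^ 2 * ‖φ κ‖))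
    rw [← integral_const_mul]
    exact integral_mono (hFint p).norm ((φ.integrable.norm.const_mul _).const_mul _) (hFnorm p)
  have h := hasSum_integral_of_summable_integral_norm hFint hsum
  have h1 : ∀ p, ∫ κ, F p κ =
      (doubleTerm α β (α + β + 1) X Z p : ℂ) * ∫ κ, mulNormSq^[p.2 + 1] φ κ := fun p =>
    integral_const_mul _ _
  have h2 : ∀ κ, ∑' p, F p κ =
      ((‖κ‖ ^ 2 * ∑' p, doubleTerm α β (α + β + 1) X (Z * ‖κ‖ ^ 2) p : ℝ) : ℂ) * φ κ := by
    intro κ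
    rw [← tsum_mul_left, Complex.ofReal_tsum, ← tsum_mul_right]
    refine tsum_congr fun p => ?_
    change (doubleTerm α β (α + β + 1) X Z p : ℂ) * mulNormSq^[p.2 + 1] φ κ = _
    rw [mulNormSq_iterate_apply, doubleTerm_mul_pow]
    push_cast
    ring
  simp_rw [h1, h2] at h
  exact h

variable {c D k : ℝ} {Q : ℝ → 𝓢'(E3, ℂ)}

/-- The pairing of the Fourier transform of a fundamental solution with a test function. -/
theorem IsFundamentalSolution.fourierDist_eq_integral (hα₀ : 0 < α) (hα₁ : α ≤ 1)
    (hαβ₁ : 1 < α + β) (hαβ₂ : α + β ≤ 2) (hc : 0 < c) (hD : 0 < D)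
    (hQ : IsFundamentalSolution α β c D k Q) {t : ℝ} (ht : 0 ≤ t) (φ : 𝓢(E3, ℂ))
    (hφ : HasCompactSupport (φ : E3 → ℂ)) :
    fourierDist (Q t) φ =
      ∫ κ : E3, (fourierKernel α β (-(c ^ 2 / D)) (k ^ 2 * D) κ t : ℂ) * φ κ := by
  have hβ : 0 < β := by linarith
  have hδ : 1 ≤ α + β + 1 := by linarith
  set x := -(c ^ 2 / D) with hx
  set z := k ^ 2 * D with hz
  have hzero : ∀ ψ : 𝓢(E3, ℂ), fourierDist (Q 0) ψ = ∫ κ, ψ κ := fun ψ => by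
    rw [hQ.initial, fourierDist_delta]
  -- Time `0` is separate since the equation holds only for `t > 0`; there the kernel is `1` because
  -- `0^(α+β) = 0`.
  rcases ht.eq_or_lt with rfl | ht
  · rw [hzero]
    refine integral_congr_ae (Eventually.of_forall fun κ => ?_)
    simp [fourierKernel, Real.zero_rpow (by linarith : α + β ≠ 0)]
  let V : ℕ → ℝ → ℂ := fun i s =>
    fourierDist (Q s) (mulNormSq^[i] φ) - fourierDist (Q 0) (mulNormSq^[i] φ)
  let m : ℕ → ℂ := fun i => fourierDist (Q 0) (mulNormSq^[i] φ)
  have hc0 : ∀ ψ : 𝓢(E3, ℂ), ContinuousOn (fun s => Q s ψ) (Ici 0) := fun ψ =>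
    continuousOn_Ici_of_contDiffOn (hQ.contDiffOn ψ) (hQ.initial_deriv ψ)
  have hV : ∀ i, ContinuousOn (V i) (Ici 0) := fun i => (hc0 _).sub continuousOn_const
  have heq : ∀ i, ∀ s : ℝ, 0 < s → V i s = (x : ℂ) * (fracInt β (V i) s
      + (z : ℂ) * fracInt (α + β) (fun r => V (i + 1) r + m (i + 1)) s) := by
    intro i s hs
    have h := integral_equation (hQ.contDiffOn (fourierSchwartz (mulNormSq^[i] φ)))
      (hQ.integrable _) (hQ.initial_deriv _) hα₀ hα₁ hαβ₁ hαβ₂ hc (D := D) (k := k)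
      (v := fun r => fourierDist (Q r) (mulNormSq^[i + 1] φ)) (fun r hr => by
        rw [hQ.equation _ r hr, laplacian_fourierDist, Function.iterate_succ_apply']) hs
    have hv : (fun r => V (i + 1) r + m (i + 1)) =
        fun r => fourierDist (Q r) (mulNormSq^[i + 1] φ) := funext fun r => sub_add_cancel _ _
    have hxz : -(k ^ 2 * c ^ 2) = x * z := by
      rw [hx, hz]
      field_simp
    rw [hv, mul_add, ← mul_assoc, ← Complex.ofReal_mul, ← hxz]
    exact h
  -- Continuity in time on the compact interval gives the pointwise bound required by uniform
  -- boundedness; initial values are subtracted to match `V`.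
  have hptw : ∀ ψ : 𝓢(E3, ℂ), ∃ B : ℝ, ∀ s : Icc (0 : ℝ) t,
      ‖(fourierDist (Q s) - fourierDist (Q 0)) ψ‖ ≤ B := by
    intro ψ
    obtain ⟨B, hB⟩ := isCompact_Icc.exists_bound_of_continuousOn
      (((hc0 (fourierSchwartz ψ)).sub (continuousOn_const (c := Q 0 (fourierSchwartz ψ)))).mono
        (Icc_subset_Ici_self : Icc 0 t ⊆ Ici 0))
    exact ⟨B, fun s => hB s s.2⟩
  obtain ⟨C, A, -, -, hCA⟩ := exists_geometric_bound
    (fun s : Icc (0 : ℝ) t => fourierDist (Q s) - fourierDist (Q 0)) hptw φ hφ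
  have hm : ∀ i, m i = ∫ κ, mulNormSq^[i] φ κ := fun i => hzero _
  have hH := hasSum_integral_doubleTerm hα₀ hβ (x * t ^ β) (z * t ^ α) φ hφ
  simp_rw [← hm] at hH
  have hsol := volterra_chain_solution hα₀ hβ hV heq ht (C := C) (A := A)
    (fun i s hs => hCA ⟨s, hs⟩ i) hH.summable
  rw [hH.tsum_eq] at hsol
  have h1 : fourierDist (Q t) φ = (∫ κ, φ κ) + V 0 t := by
    change _ = _ + (fourierDist (Q t) φ - fourierDist (Q 0) φ)
    rw [hzero]
    ring
  have hcontH : Continuous fun κ : E3 =>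
      ((fourierKernel α β x z κ t - 1 : ℝ) : ℂ) * φ κ :=
    (Complex.continuous_ofReal.comp
      ((continuous_fourierKernel hα₀ hβ x z t).sub continuous_const)).mul φ.continuous
  have hintH : Integrable fun κ : E3 => ((fourierKernel α β x z κ t - 1 : ℝ) : ℂ) * φ κ :=
    hcontH.integrable_of_hasCompactSupport hφ.mul_left
  rw [h1, hsol, ← integral_const_mul]
  have h2 : ∀ κ : E3, ((x * z * t ^ (α + β) : ℝ) : ℂ) * (((‖κ‖ ^ 2 *
      ∑' p, doubleTerm α β (α + β + 1) (x * t ^ β) (z * t ^ α * ‖κ‖ ^ 2) p : ℝ) : ℂ) * φ κ)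
      = ((fourierKernel α β x z κ t - 1 : ℝ) : ℂ) * φ κ := by
    intro κ
    unfold fourierKernel
    rw [← mul_assoc, ← Complex.ofReal_mul]
    congr 2
    ring
  simp_rw [h2]
  rw [← integral_add φ.integrable hintH]
  refine integral_congr_ae (Eventually.of_forall fun κ => ?_)
  simp only
  push_cast
  ring

end Kernel

end FracHyp

/-! ### Both series representations -/

theorem theorem1 (α β c D k : ℝ) (hα₀ : 0 < α) (hα₁ : α ≤ 1) (hαβ₁ : 1 < α + β)
    (hαβ₂ : α + β ≤ 2) (hc : 0 < c) (hD : 0 < D)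
    (Q : ℝ → 𝓢'(FracHyp.E3, ℂ)) (hQ : FracHyp.IsFundamentalSolution α β c D k Q) :
    ∃ H : FracHyp.E3 → ℝ → ℝ,
      (∀ t : ℝ, 0 ≤ t →
        FracHyp.IsContinuousFunction (FracHyp.fourierDist (Q t)) (fun κ => (H κ t : ℂ))) ∧
      ∀ (κ : FracHyp.E3) (t : ℝ), 0 ≤ t →
        (∀ n : ℕ, Summable (FracHyp.prabhakarTerm ((n : ℝ) + 1) β
          ((α + β) * ((n : ℝ) + 1) + 1) (-(c ^ 2 / D) * t ^ β))) ∧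
        (Summable fun n : ℕ => (-(k ^ 2 * ‖κ‖ ^ 2 * c ^ 2 * t ^ (α + β))) ^ (n + 1) *
          FracHyp.prabhakar ((n : ℝ) + 1) β ((α + β) * ((n : ℝ) + 1) + 1)
            (-(c ^ 2 / D) * t ^ β)) ∧
        H κ t = 1 + ∑' n : ℕ, (-(k ^ 2 * ‖κ‖ ^ 2 * c ^ 2 * t ^ (α + β))) ^ (n + 1) *
          FracHyp.prabhakar ((n : ℝ) + 1) β ((α + β) * ((n : ℝ) + 1) + 1)
            (-(c ^ 2 / D) * t ^ β) ∧
        (Summable fun p : ℕ × ℕ => (p.1.choose p.2 : ℝ) *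
          ((-(c ^ 2 / D) * t ^ β) ^ p.1 * (k ^ 2 * ‖κ‖ ^ 2 * D * t ^ α) ^ p.2) /
            Real.Gamma (β * p.1 + α * p.2 + α + β + 1)) ∧
        H κ t = 1 - k ^ 2 * ‖κ‖ ^ 2 * c ^ 2 * t ^ (α + β) *
          ∑' (m : ℕ) (n : ℕ), (m.choose n : ℝ) *
            ((-(c ^ 2 / D) * t ^ β) ^ m * (k ^ 2 * ‖κ‖ ^ 2 * D * t ^ α) ^ n) /
              Real.Gamma (β * m + α * n + α + β + 1) := by

  have hβ : 0 < β := by linarith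
  have hδ : 1 ≤ α + β + 1 := by linarith
  refine ⟨FracHyp.fourierKernel α β (-(c ^ 2 / D)) (k ^ 2 * D), fun t ht =>
    ⟨Complex.continuous_ofReal.comp (FracHyp.continuous_fourierKernel hα₀ hβ _ _ t), fun φ hφ =>
      hQ.fourierDist_eq_integral hα₀ hα₁ hαβ₁ hαβ₂ hc hD ht φ hφ⟩, fun κ t ht => ?_⟩
  set X := -(c ^ 2 / D) * t ^ β with hX
  -- Nonnegativity of both exponents makes this valid at `t = 0` as well.
  have htαβ : t ^ (α + β) = t ^ α * t ^ β := Real.rpow_add_of_nonneg ht hα₀.le hβ.le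
  have hZ : k ^ 2 * D * t ^ α * ‖κ‖ ^ 2 = k ^ 2 * ‖κ‖ ^ 2 * D * t ^ α := by ring
  set Z := k ^ 2 * ‖κ‖ ^ 2 * D * t ^ α with hZdef
  have hY : -(k ^ 2 * ‖κ‖ ^ 2 * c ^ 2 * t ^ (α + β)) = X * Z := by
    rw [htαβ, hX, hZdef]
    field_simp
  have hker : FracHyp.fourierKernel α β (-(c ^ 2 / D)) (k ^ 2 * D) κ t =
      1 + X * Z * ∑' p, FracHyp.doubleTerm α β (α + β + 1) X Z p := by
    unfold FracHyp.fourierKernel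
    rw [hZ, ← hX, ← hY]
    congr 2
    field_simp
  have hterm : (fun p : ℕ × ℕ => (p.1.choose p.2 : ℝ) * (X ^ p.1 * Z ^ p.2) /
      Real.Gamma (β * p.1 + α * p.2 + α + β + 1)) = FracHyp.doubleTerm α β (α + β + 1) X Z := by
    ext p
    rw [FracHyp.doubleTerm, add_assoc (β * (p.1 : ℝ) + α * p.2) α β,
      add_assoc (β * (p.1 : ℝ) + α * p.2) (α + β) 1]
  have hdouble := FracHyp.summable_doubleTerm hα₀ hβ hδ X Z
  have hprab := FracHyp.hasSum_prabhakar hα₀ hβ X Z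
  rw [hY]
  refine ⟨FracHyp.summable_prabhakarTerm hα₀ hβ X, hprab.summable, ?_, ?_, ?_⟩
  · rw [hker, hprab.tsum_eq]
  · rw [hterm]
    exact hdouble
  · rw [hker, hdouble.tsum_prod, ← hterm, ← hY, neg_mul, ← sub_eq_add_neg]
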